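/- Let $G$ be a finite $2$-group and let $\operatorname{Irr}(G)$ be the set of its irreducible complex characters. A character $\chi\in\operatorname{Irr}(G)$ is called rational if the field $\mathbb{Q}(\chi)=\mathbb{Q}(\chi(g) : g\in G)$ equals $\mathbb{Q}$, and an element $x\in G$ (equivalently, its conjugacy class) is called rational if the field $\mathbb{Q}(x)=\mathbb{Q}(\psi(x) : \psi\in\operatorname{Irr}(G))$ equals $\mathbb{Q}$. Let $\operatorname{Irr}_{\mathbb{Q}}(G)$ be the set of rational irreducible characters of $G$ and $\operatorname{cl}_{\mathbb{Q}}(G)$ the set of rational conjugacy classes of $G$. If $|\operatorname{Irr}_{\mathbb{Q}}(G)|\le 5$, then $|\operatorname{cl}_{\mathbb{Q}}(G)|=|\operatorname{Irr}_{\mathbb{Q}}(G)|$. -/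

import Mathlib

/-- The set `Irr(G)` of complex irreducible characters of `G`: the functions `g ↦ tr ρ(g)`, for `ρ`
a finite-dimensional irreducible complex representation of `G`. Every finite-dimensional
representation is isomorphic to one on some `Fin n → ℂ`, and isomorphic representations have the
same character (see `character_mem_Irr`). -/
def Irr (G : Type*) [Group G] : Set (G → ℂ) :=
  {χ | ∃ (n : ℕ) (ρ : Representation ℂ G (Fin n → ℂ)), ρ.IsIrreducible ∧ ρ.character = χ}

/-- The field of values `ℚ(χ)`, generated over `ℚ` by the values `χ(g)`, `g ∈ G`. -/
noncomputable def charField {G : Type*} (χ : G → ℂ) : IntermediateField ℚ ℂ :=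
  IntermediateField.adjoin ℚ (Set.range χ)

/-- The field `ℚ(x)`, generated over `ℚ` by the values `ψ(x)`, `ψ ∈ Irr(G)`. -/
noncomputable def elementField {G : Type*} [Group G] (x : G) : IntermediateField ℚ ℂ :=
  IntermediateField.adjoin ℚ {z : ℂ | ∃ ψ ∈ Irr G, ψ x = z}

/-- `χ` is rational if `ℚ(χ) = ℚ`. -/
def IsRationalChar {G : Type*} (χ : G → ℂ) : Prop := charField χ = ⊥

/-- `x` is rational if `ℚ(x) = ℚ`. -/
def IsRationalElement {G : Type*} [Group G] (x : G) : Prop := elementField x = ⊥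

/-- The set `Irr_ℚ(G)` of rational irreducible characters. -/
def IrrQ (G : Type*) [Group G] : Set (G → ℂ) := {χ | χ ∈ Irr G ∧ IsRationalChar χ}

/-- The set `cl_ℚ(G)` of conjugacy classes of rational elements. -/
def clQ (G : Type*) [Group G] : Set (ConjClasses G) :=
  {K | ∃ x : G, IsRationalElement x ∧ ConjClasses.mk x = K}

/-- The character of any finite-dimensional irreducible complex representation is in `Irr G`. -/
theorem character_mem_Irr {G V : Type*} [Group G] [AddCommGroup V] [Module ℂ V]
    [FiniteDimensional ℂ V] (ρ : Representation ℂ G V) (hρ : ρ.IsIrreducible) :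
    ρ.character ∈ Irr G := by
  let e : V ≃ₗ[ℂ] (Fin (Module.finrank ℂ V) → ℂ) := (Module.finBasis ℂ V).equivFun
  let σ : Representation ℂ G (Fin (Module.finrank ℂ V) → ℂ) :=
    (e.conjAlgEquiv ℂ : _ →* _).comp ρ
  have hσ : ∀ g v, σ g (e v) = e (ρ g v) := by
    intro g v
    simp [σ, LinearEquiv.conjAlgEquiv_apply]
  let φ : ρ.Equiv σ := Representation.Equiv.mk e (by
    intro g
    ext v
    simp [hσ])
  refine ⟨_, σ, ?_, (Representation.char_iso φ).symm⟩
  have hmem : ∀ (τ : Subrepresentation ρ) (g : G) (w : Fin (Module.finrank ℂ V) → ℂ),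
      e.symm w ∈ τ.toSubmodule → e.symm (σ g w) ∈ τ.toSubmodule := by
    intro τ g w hw
    have h1 : σ g w = e (ρ g (e.symm w)) := by rw [← hσ, e.apply_symm_apply]
    rw [h1, e.symm_apply_apply]
    exact τ.apply_mem_toSubmodule g hw
  let f : Subrepresentation σ ≃o Subrepresentation ρ :=
    { toFun := fun τ => ⟨τ.toSubmodule.comap e.toLinearMap, fun g v hv => by
        simpa [← hσ] using τ.apply_mem_toSubmodule g hv⟩
      invFun := fun τ => ⟨τ.toSubmodule.comap e.symm.toLinearMap, fun g w hw => hmem τ g w hw⟩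
      left_inv := fun τ => Subrepresentation.toSubmodule_injective (by ext; simp)
      right_inv := fun τ => Subrepresentation.toSubmodule_injective (by ext; simp)
      map_rel_iff' := fun {a b} =>
        ⟨fun h w hw => by
            have hw' : e.symm w ∈ a.toSubmodule.comap e.toLinearMap := by
              rw [Submodule.mem_comap, LinearEquiv.coe_coe, e.apply_symm_apply]; exact hw
            have h2 : e (e.symm w) ∈ b.toSubmodule := h hw'
            rw [e.apply_symm_apply] at h2; exact h2,
          fun h v hv => h (show e v ∈ a.toSubmodule from hv)⟩ }
  exact f.isSimpleOrder_iff.mpr hρ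

/-!
Let `G` be a finite `2`-group with at most five rational irreducible characters, and write `sqs H`
for the subgroup generated by the squares of the elements of `H`, so that `Φ = sqs ⊤` is the Frattini
subgroup. The characters of order at most two are rational and number `|G : Φ|` (`encard_signChars`),
so `|G : Φ| ≤ 4`. The argument depends on whether `G` is powerful, that is, `G' ≤ sqs (sqs ⊤)`.

*Powerful groups.* Being central modulo the squares of the squares passes from a normal subgroup `N`
to `sqs N` (`PowEmb.sqs`), which allows inductions along the series `⊤ ≥ sqs ⊤ ≥ sqs (sqs ⊤) ≥ ⋯`.
Going up the series, a rational irreducible representation is trivial on each `sqs N`: it is central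
on `N`, and a rational root of unity is `±1`. Hence all rational irreducible characters are
linear (`IrrQ_eq_signChars`). On the other side, a rational element `x` of `N` is conjugate
to `x⁻¹`, so `x ^ 2` lies two steps further down; counting along the series shows that there are
`|G : Φ|` rational classes (`PowEmb.encard_ratCl`). The only delicate step is the one where the factor
`N / sqs N` has order four and the next has order two, so that `sqs N` is cyclic
(`exists_two_rational_classes`).

*Non-powerful groups.* A sign of `Φ` which is trivial on `[Φ, G]` and not on `G'` yields a
rational irreducible character vanishing outside `Φ` (`exists_mem_IrrQ_of_sign`). Such signs exist,
and at most one is allowed by the hypothesis, which forces `G' = Φ` with index four and five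
rational irreducible characters (`sqs_top_eq_commutator_of_not_powEmb`). By Taussky's theorem
(`IsPGroup.exists_zpowers_index_two`) `G` has a cyclic subgroup of index two, and its rational
classes can be listed: there are five (`encard_clQ_eq_five`).

Two facts relate characters to elements: a rational element `x` is conjugate to `x ^ j` for `j` prime
to its order (`IsRationalElement.isConj_pow`), because irreducible characters separate classes; and
an element of order dividing four that is conjugate to its inverse is rational
(`isRationalElement_of_pow_four`).
-/

open scoped commutatorElement

/-! ### Eigenvalues of endomorphisms of finite order -/

/-- An endomorphism of finite order is diagonalisable, so the traces of its powers are the power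
sums of a multiset of roots of unity. -/
theorem exists_multiset_trace_pow {V : Type*} [AddCommGroup V] [Module ℂ V]
    [FiniteDimensional ℂ V] (T : Module.End ℂ V) {n : ℕ} (hn : n ≠ 0) (hT : T ^ n = 1) :
    ∃ s : Multiset ℂ, (∀ μ ∈ s, μ ^ n = 1) ∧
      ∀ j : ℕ, LinearMap.trace ℂ V (T ^ j) = (s.map (· ^ j)).sum := by
  classical
  have hss : T.IsSemisimple := by
    refine Module.End.isSemisimple_of_squarefree_aeval_eq_zero
      (p := (Polynomial.X ^ n - 1 : Polynomial ℂ)) ?_ (by simp [hT])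
    exact (Polynomial.separable_X_pow_sub_C (1 : ℂ) (by exact_mod_cast hn) one_ne_zero).squarefree
  have hint : DirectSum.IsInternal T.eigenspace :=
    (DirectSum.isInternal_submodule_iff_iSupIndep_and_iSup_eq_top _).2
      ⟨T.eigenspaces_iSupIndep, hss.iSup_eigenspace_eq_top⟩
  let b := hint.collectedBasis fun μ => Module.finBasis ℂ (T.eigenspace μ)
  have hb : ∀ i, T (b i) = i.1 • b i := fun i =>
    Module.End.mem_eigenspace_iff.1 (hint.collectedBasis_mem _ i)
  have hbj : ∀ (j : ℕ) i, (T ^ j) (b i) = i.1 ^ j • b i := by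
    intro j i
    induction j with
    | zero => simp
    | succ k ih => rw [pow_succ', Module.End.mul_apply, ih, map_smul, hb, smul_smul, pow_succ]
  let _ : Fintype (Σ μ : ℂ, Fin (Module.finrank ℂ (T.eigenspace μ))) :=
    FiniteDimensional.fintypeBasisIndex b
  refine ⟨Finset.univ.val.map fun i : Σ μ : ℂ, Fin (Module.finrank ℂ (T.eigenspace μ)) => i.1,
    ?_, fun j => ?_⟩
  · intro μ hμ
    obtain ⟨i, -, rfl⟩ := Multiset.mem_map.1 hμ
    have h := hbj n i
    rw [hT, Module.End.one_apply] at h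
    have h2 : (i.1 ^ n - 1) • b i = 0 := by rw [sub_smul, ← h, one_smul, sub_self]
    exact sub_eq_zero.1 ((smul_eq_zero.1 h2).resolve_right (b.ne_zero i))
  · rw [LinearMap.trace_eq_matrix_trace ℂ b, Matrix.trace, Multiset.map_map]
    refine Finset.sum_congr rfl fun i _ => ?_
    simp [LinearMap.toMatrix_apply, hbj]

/-! ### Rationality of characters and of elements -/

theorem adjoin_rat_eq_bot_iff (S : Set ℂ) :
    IntermediateField.adjoin ℚ S = ⊥ ↔ ∀ z ∈ S, ∃ q : ℚ, z = q := by
  rw [IntermediateField.adjoin_eq_bot_iff]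
  refine forall₂_congr fun z _ => ?_
  rw [SetLike.mem_coe, IntermediateField.mem_bot]
  exact ⟨fun ⟨q, hq⟩ => ⟨q, by simpa using hq.symm⟩, fun ⟨q, hq⟩ => ⟨q, by simpa using hq.symm⟩⟩

theorem isRationalChar_iff {G : Type*} {χ : G → ℂ} :
    IsRationalChar χ ↔ ∀ g, ∃ q : ℚ, χ g = q := by
  rw [IsRationalChar, charField, adjoin_rat_eq_bot_iff, Set.forall_mem_range]

theorem isRationalElement_iff {G : Type*} [Group G] {x : G} :
    IsRationalElement x ↔ ∀ ψ ∈ Irr G, ∃ q : ℚ, ψ x = q := by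
  rw [IsRationalElement, elementField, adjoin_rat_eq_bot_iff]
  exact ⟨fun h ψ hψ => h _ ⟨ψ, hψ, rfl⟩, fun h z ⟨ψ, hψ, hz⟩ => hz ▸ h ψ hψ⟩

/-- If a character takes a rational value at `x`, it takes the same value at the powers `x ^ j`
with `j` prime to the order. The value at `x` being `q`, the polynomial
`∑ X ^ kᵢ - q` over `ℚ`, where the eigenvalues of `x` are `ζ ^ kᵢ`, vanishes at `ζ`, so it vanishes
at the conjugate `ζ ^ j`. -/
theorem character_pow_eq_of_rational {G V : Type*} [Group G] [AddCommGroup V] [Module ℂ V]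
    [FiniteDimensional ℂ V] (ρ : Representation ℂ G V) {x : G} {n j : ℕ} (hn : n ≠ 0)
    (hx : x ^ n = 1) (hj : j.Coprime n) {q : ℚ} (hq : ρ.character x = q) :
    ρ.character (x ^ j) = q := by
  obtain ⟨s, hs, htr⟩ := exists_multiset_trace_pow (ρ x) hn (by rw [← map_pow, hx, map_one])
  have : NeZero n := ⟨hn⟩
  have hζ := Complex.isPrimitiveRoot_exp n hn
  set ζ := Complex.exp (2 * Real.pi * Complex.I / n)
  choose! k hk using fun μ (hμ : μ ∈ s) => hζ.eq_pow_of_pow_eq_one (hs μ hμ)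
  let f : Polynomial ℚ := (s.map fun μ => (Polynomial.X : Polynomial ℚ) ^ k μ).sum - .C q
  have hf : ∀ i : ℕ, Polynomial.aeval (ζ ^ i) f = ρ.character (x ^ i) - q := by
    intro i
    rw [Representation.character, map_pow, htr]
    simp only [f, map_sub, Polynomial.aeval_C, map_multiset_sum, Multiset.map_map,
      Function.comp_def, map_pow, Polynomial.aeval_X]
    congr 2
    refine Multiset.map_congr rfl fun μ hμ => ?_
    rw [← pow_mul, mul_comm i, pow_mul, (hk μ hμ).2]
  have h1 : Polynomial.aeval ζ f = 0 := by
    have := hf 1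
    rwa [pow_one, pow_one, hq, sub_self] at this
  have h2 : minpoly ℚ ζ = minpoly ℚ (ζ ^ j) := by
    rw [← Polynomial.cyclotomic_eq_minpoly_rat hζ (Nat.pos_of_ne_zero hn),
      ← Polynomial.cyclotomic_eq_minpoly_rat (hζ.pow_of_coprime j hj) (Nat.pos_of_ne_zero hn)]
  have h3 : Polynomial.aeval (ζ ^ j) f = 0 := by
    obtain ⟨g, hg⟩ := minpoly.dvd ℚ ζ h1
    rw [hg, h2, map_mul, minpoly.aeval, zero_mul]
  rw [hf] at h3
  exact sub_eq_zero.1 h3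

/-- A character that agrees at `x` and `x⁻¹`, where `x ^ 4 = 1`, is rational at `x`: twice its
value is a sum of terms `μ + μ³` with `μ ^ 4 = 1`, and these are `0`, `2` or `-2`. -/
theorem character_rational_of_pow_four {G V : Type*} [Group G] [AddCommGroup V] [Module ℂ V]
    [FiniteDimensional ℂ V] (ρ : Representation ℂ G V) {x : G} (hx : x ^ 4 = 1)
    (hinv : ρ.character x = ρ.character x⁻¹) : ∃ q : ℚ, ρ.character x = q := by
  obtain ⟨s, hs, htr⟩ := exists_multiset_trace_pow (ρ x) four_ne_zero
    (by rw [← map_pow, hx, map_one])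
  have h3 : x⁻¹ = x ^ 3 := by rw [inv_eq_iff_mul_eq_one, ← pow_succ', hx]
  have h1 : ρ.character x = (s.map (· ^ 1)).sum := by
    rw [← htr, pow_one, Representation.character]
  have h2 : ρ.character x = (s.map (· ^ 3)).sum := by
    rw [hinv, h3, ← htr, Representation.character, map_pow]
  have h4 : ∃ q : ℚ, (s.map fun μ : ℂ => μ ^ 1 + μ ^ 3).sum = (q : ℂ) := by
    have h0 : ∀ t ≤ s, ∃ q : ℚ, (t.map fun μ : ℂ => μ ^ 1 + μ ^ 3).sum = (q : ℂ) := by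
      intro t
      induction t using Multiset.induction with
      | empty => exact fun _ => ⟨0, by simp⟩
      | cons μ t ih =>
        intro ht
        obtain ⟨q, hq⟩ := ih ((Multiset.le_cons_self t μ).trans ht)
        have hμ := hs μ (Multiset.mem_of_le ht (Multiset.mem_cons_self μ t))
        have h5 : (μ - 1) * (μ + 1) * (μ ^ 2 + 1) = 0 := by linear_combination hμ
        rw [Multiset.map_cons, Multiset.sum_cons, hq]
        rcases mul_eq_zero.1 h5 with h5 | h5
        · rcases mul_eq_zero.1 h5 with h5 | h5
          · exact ⟨2 + q, by push_cast; linear_combination (μ ^ 2 + μ + 2) * h5⟩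
          · exact ⟨-2 + q, by push_cast; linear_combination (μ ^ 2 - μ + 2) * h5⟩
        · exact ⟨q, by linear_combination μ * h5⟩
    exact h0 s le_rfl
  obtain ⟨q, hq⟩ := h4
  refine ⟨q / 2, ?_⟩
  rw [Multiset.sum_map_add, ← h1, ← h2] at hq
  push_cast
  linear_combination hq / 2

/-! ### Irreducible representations -/

theorem Subrepresentation.isIrreducible_toRepresentation_of_isAtom {G V : Type*} [Group G]
    [AddCommGroup V] [Module ℂ V] {ρ : Representation ℂ G V} {U : Subrepresentation ρ}
    (hU : IsAtom U) : U.toRepresentation.IsIrreducible := by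
  have key : ∀ τ : Subrepresentation U.toRepresentation, τ = ⊥ ∨ τ = ⊤ := by
    intro τ
    let τ' : Subrepresentation ρ := ⟨τ.toSubmodule.map U.toSubmodule.subtype, by
      rintro g _ ⟨v, hv, rfl⟩
      exact ⟨_, τ.apply_mem_toSubmodule g hv, rfl⟩⟩
    have hle : τ' ≤ U := by
      rintro _ ⟨v, -, rfl⟩
      exact v.2
    rcases hU.le_iff.1 hle with h | h
    · left
      apply Subrepresentation.toSubmodule_injective
      have h' : τ.toSubmodule.map U.toSubmodule.subtype = ⊥ :=
        congrArg Subrepresentation.toSubmodule h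
      exact Submodule.map_injective_of_injective U.toSubmodule.injective_subtype
        (h'.trans (Submodule.map_bot _).symm)
    · right
      apply Subrepresentation.toSubmodule_injective
      refine eq_top_iff.2 ?_
      intro v _
      have hv : (v : V) ∈ τ' := h.ge v.2
      obtain ⟨w, hw, hwv⟩ := hv
      rwa [← Subtype.ext hwv]
  have hne : (⊥ : Subrepresentation U.toRepresentation) ≠ ⊤ := by
    intro h
    have h' : (⊥ : Submodule ℂ U.toSubmodule) = ⊤ := congrArg Subrepresentation.toSubmodule h
    refine hU.1 (Subrepresentation.toSubmodule_injective ?_)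
    refine (Submodule.eq_bot_iff _).2 fun v hv => ?_
    have hv' : (⟨v, hv⟩ : U.toSubmodule) ∈ (⊥ : Submodule ℂ U.toSubmodule) := h' ▸ trivial
    exact congrArg Subtype.val ((Submodule.mem_bot ℂ).1 hv')
  have : Nontrivial (Subrepresentation U.toRepresentation) := ⟨⟨_, _, hne⟩⟩
  exact ⟨key⟩

theorem Subrepresentation.exists_irreducible_le {G V : Type*} [Group G] [AddCommGroup V]
    [Module ℂ V] [FiniteDimensional ℂ V] {ρ : Representation ℂ G V} {W : Subrepresentation ρ}
    (hW : W ≠ ⊥) : ∃ U ≤ W, U.toRepresentation.IsIrreducible := by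
  have hmono : StrictMono (Subrepresentation.toSubmodule : Subrepresentation ρ → _) :=
    Monotone.strictMono_of_injective (fun _ _ h => h) Subrepresentation.toSubmodule_injective
  have : WellFoundedLT (Subrepresentation ρ) := hmono.wellFoundedLT
  obtain ⟨U, hU, hUW⟩ := (eq_bot_or_exists_atom_le W).resolve_left hW
  exact ⟨U, hUW, isIrreducible_toRepresentation_of_isAtom hU⟩

/-- Schur's lemma. -/
theorem Representation.IsIrreducible.exists_eq_smul {G V : Type*} [Group G] [AddCommGroup V]
    [Module ℂ V] [FiniteDimensional ℂ V] {ρ : Representation ℂ G V} (hρ : ρ.IsIrreducible)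
    (f : V →ₗ[ℂ] V) (hf : ∀ g v, f (ρ g v) = ρ g (f v)) : ∃ c : ℂ, ∀ v, f v = c • v := by
  let F : Representation.IntertwiningMap ρ ρ := ⟨f, fun g => by ext v; simp [hf]⟩
  obtain ⟨c, hc⟩ :=
    (Representation.IsIrreducible.algebraMap_intertwiningMap_bijective_of_isAlgClosed
      (ρ := ρ)).2 F
  refine ⟨c, fun v => ?_⟩
  have : F v = (algebraMap ℂ (Representation.IntertwiningMap ρ ρ) c) v := by rw [hc]
  exact this

theorem Representation.IsIrreducible.nontrivial {G V : Type*} [Group G] [AddCommGroup V]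
    [Module ℂ V] {ρ : Representation ℂ G V} (hρ : ρ.IsIrreducible) : Nontrivial V := by
  by_contra h
  rw [not_nontrivial_iff_subsingleton] at h
  obtain ⟨a, b, hab⟩ := hρ.toNontrivial
  exact hab (Subrepresentation.toSubmodule_injective (Subsingleton.elim _ _))

/-- The right regular representation of `G` on functions `G → ℂ`. -/
def rightRegular (G : Type*) [Group G] : Representation ℂ G (G → ℂ) where
  toFun g := LinearMap.funLeft ℂ ℂ (· * g)
  map_one' := by ext; simp [LinearMap.funLeft]
  map_mul' g h := by ext; simp [LinearMap.funLeft, mul_assoc]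

theorem rightRegular_apply {G : Type*} [Group G] (g x : G) (f : G → ℂ) :
    rightRegular G g f x = f (x * g) := rfl

theorem Irr.apply_eq_of_isConj {G : Type*} [Group G] {ψ : G → ℂ} (hψ : ψ ∈ Irr G) {x y : G}
    (h : IsConj x y) : ψ x = ψ y := by
  obtain ⟨n, ρ, -, rfl⟩ := hψ
  obtain ⟨c, rfl⟩ := isConj_iff.1 h
  exact (ρ.char_conj x c).symm

/-- Irreducible characters separate conjugacy classes: the operator
`∑ g, ρ (g * x * g⁻¹) - ρ (g * y * g⁻¹)` is by Schur's lemma a scalar of trace zero on every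
irreducible representation, so it vanishes on the regular one. -/
theorem isConj_of_forall_Irr {G : Type*} [Group G] [Finite G] {x y : G}
    (h : ∀ ψ ∈ Irr G, ψ x = ψ y) : IsConj x y := by
  classical
  let _ := Fintype.ofFinite G
  let c {V : Type _} [AddCommGroup V] [Module ℂ V] (ρ : Representation ℂ G V) : V →ₗ[ℂ] V :=
    ∑ g : G, (ρ (g * x * g⁻¹) - ρ (g * y * g⁻¹))
  have hcomm : ∀ {V : Type _} [AddCommGroup V] [Module ℂ V] (ρ : Representation ℂ G V) (k : G)
      (v : V), c ρ (ρ k v) = ρ k (c ρ v) := by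
    intro V _ _ ρ k v
    simp only [c, LinearMap.sum_apply, LinearMap.sub_apply, map_sum, map_sub]
    rw [← Equiv.sum_comp (Equiv.mulLeft k)]
    refine Finset.sum_congr rfl fun g _ => ?_
    simp only [Equiv.coe_mulLeft, ← Module.End.mul_apply, ← map_mul]
    congr 3 <;> group
  have hirr : ∀ {V : Type _} [AddCommGroup V] [Module ℂ V] [FiniteDimensional ℂ V]
      (ρ : Representation ℂ G V), ρ.IsIrreducible → c ρ = 0 := by
    intro V _ _ _ ρ hρ
    obtain ⟨a, ha⟩ := hρ.exists_eq_smul (c ρ) (hcomm ρ)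
    have := hρ.nontrivial
    have h1 : c ρ = a • LinearMap.id := by ext v; simp [ha]
    have h2 : LinearMap.trace ℂ V (c ρ) = 0 := by
      simp only [c, map_sum, map_sub]
      refine Finset.sum_eq_zero fun g _ => sub_eq_zero.2 ?_
      have := h _ (character_mem_Irr ρ hρ)
      rw [← ρ.char_conj x g, ← ρ.char_conj y g] at this
      exact this
    rw [h1, map_smul, LinearMap.trace_id, smul_eq_mul, mul_eq_zero] at h2
    rw [h1, h2.resolve_right (by exact_mod_cast Module.finrank_pos.ne'), zero_smul]
  let K : Subrepresentation (rightRegular G) :=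
    ⟨LinearMap.ker (c (rightRegular G)), fun g v hv => by
      rw [LinearMap.mem_ker] at hv ⊢
      rw [hcomm, hv, map_zero]⟩
  obtain ⟨Q, hQ⟩ := exists_isCompl K
  have hQ0 : Q = ⊥ := by
    by_contra hne
    obtain ⟨U, hUQ, hU⟩ := Subrepresentation.exists_irreducible_le hne
    have hUK : U ≤ K := by
      intro u hu
      have h3 := congrArg Subtype.val (LinearMap.congr_fun (hirr _ hU) ⟨u, hu⟩)
      change c (rightRegular G) u = 0
      simpa [c, Subrepresentation.toRepresentation, LinearMap.sum_apply] using h3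
    have hU0 : U = ⊥ := le_bot_iff.1 (hQ.disjoint hUK hUQ)
    have := hU.nontrivial
    obtain ⟨v, hv⟩ := exists_ne (0 : U.toSubmodule)
    have hv' : (v : G → ℂ) ∈ (⊥ : Subrepresentation (rightRegular G)) := hU0 ▸ v.2
    exact hv (Subtype.ext ((Submodule.mem_bot ℂ).1 hv'))
  have hK : K = ⊤ := by
    have := hQ.sup_eq_top
    rwa [hQ0, sup_bot_eq] at this
  have hzero : c (rightRegular G) (Pi.single x 1) = 0 := by
    have : (Pi.single x 1 : G → ℂ) ∈ K := hK ▸ (trivial : _ ∈ (⊤ : Submodule ℂ (G → ℂ)))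
    exact this
  by_contra hxy
  have h4 := congrFun hzero 1
  simp only [c, LinearMap.sum_apply, LinearMap.sub_apply, Finset.sum_apply, Pi.sub_apply,
    rightRegular_apply, one_mul, Pi.zero_apply] at h4
  have h5 : ∀ g : G, (Pi.single x 1 : G → ℂ) (g * y * g⁻¹) = 0 := fun g =>
    Pi.single_eq_of_ne (fun hg => hxy (isConj_iff.2 ⟨g, hg⟩).symm) _
  simp only [h5, sub_zero, Pi.single_apply, Finset.sum_boole, Nat.cast_eq_zero,
    Finset.card_eq_zero] at h4
  have h6 := Finset.filter_eq_empty_iff.1 h4 (Finset.mem_univ 1)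
  simp at h6

theorem IsRationalElement.isConj_pow {G : Type*} [Group G] [Finite G] {x : G}
    (hx : IsRationalElement x) {j : ℕ} (hj : j.Coprime (orderOf x)) : IsConj x (x ^ j) := by
  refine isConj_of_forall_Irr fun ψ hψ => ?_
  obtain ⟨q, hq⟩ := isRationalElement_iff.1 hx ψ hψ
  obtain ⟨n, ρ, -, rfl⟩ := hψ
  rw [hq, character_pow_eq_of_rational ρ (orderOf_pos x).ne' (pow_orderOf_eq_one x) hj hq]

theorem IsRationalElement.isConj_inv {G : Type*} [Group G] [Finite G] {x : G}
    (hx : IsRationalElement x) : IsConj x x⁻¹ := by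
  have h : x⁻¹ = x ^ (orderOf x - 1) := by
    rw [inv_eq_iff_mul_eq_one, ← pow_succ', Nat.sub_add_cancel (orderOf_pos x), pow_orderOf_eq_one]
  rw [h]
  refine hx.isConj_pow ?_
  rw [Nat.coprime_comm]
  exact (Nat.coprime_self_sub_right (orderOf_pos x)).2 (Nat.coprime_one_right _)

theorem isRationalElement_of_pow_four {G : Type*} [Group G] {x : G} (hx : x ^ 4 = 1)
    (hinv : IsConj x x⁻¹) : IsRationalElement x := by
  refine isRationalElement_iff.2 fun ψ hψ => ?_
  have h := Irr.apply_eq_of_isConj hψ hinv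
  obtain ⟨n, ρ, -, rfl⟩ := hψ
  exact character_rational_of_pow_four ρ hx h

theorem isRationalElement_of_sq {G : Type*} [Group G] {x : G} (hx : x ^ 2 = 1) :
    IsRationalElement x := by
  refine isRationalElement_of_pow_four (by rw [show 4 = 2 * 2 from rfl, pow_mul, hx, one_pow]) ?_
  rw [inv_eq_iff_mul_eq_one.2 (by rw [← sq, hx])]

/-! ### Linear characters and characters induced by invariant signs -/

theorem exists_rat_eq_of_sq_eq_one {z : ℂ} (hz : z ^ 2 = 1) : ∃ q : ℚ, z = q := by
  rcases mul_self_eq_one_iff.1 ((sq z).symm.trans hz) with h | h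
  · exact ⟨1, by simp [h]⟩
  · exact ⟨-1, by simp [h]⟩

theorem linear_mem_IrrQ {G : Type*} [Group G] (l : G →* ℂˣ) (hl : ∀ g, l (g ^ 2) = 1) :
    (fun g => (l g : ℂ)) ∈ IrrQ G := by
  let ρ : Representation ℂ G ℂ :=
    { toFun := fun g => (l g : ℂ) • LinearMap.id
      map_one' := by ext; simp
      map_mul' := fun g h => by ext; simp [mul_comm] }
  have hχ : ρ.character = fun g => (l g : ℂ) := by
    ext g
    change LinearMap.trace ℂ ℂ ((l g : ℂ) • LinearMap.id) = l g
    rw [map_smul, LinearMap.trace_id]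
    simp
  have hirr : ρ.IsIrreducible := by
    have key : ∀ τ : Subrepresentation ρ, τ = ⊥ ∨ τ = ⊤ := fun τ =>
      (eq_bot_or_eq_top τ.toSubmodule).imp (fun h => Subrepresentation.toSubmodule_injective h)
        (fun h => Subrepresentation.toSubmodule_injective h)
    have : Nontrivial (Subrepresentation ρ) :=
      ⟨⟨⊥, ⊤, fun h => bot_ne_top (α := Submodule ℂ ℂ)
        (congrArg Subrepresentation.toSubmodule h)⟩⟩
    exact ⟨key⟩
  refine ⟨hχ ▸ character_mem_Irr ρ hirr, isRationalChar_iff.2 fun g => ?_⟩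
  refine exists_rat_eq_of_sq_eq_one ?_
  rw [← Units.val_pow_eq_pow_val, ← map_pow, hl, Units.val_one]

/-- If an irreducible representation with rational character is central at `h`, it is `±1` there. -/
theorem Representation.IsIrreducible.sq_eq_one_of_rational {G V : Type*} [Group G] [Finite G]
    [AddCommGroup V] [Module ℂ V] [FiniteDimensional ℂ V] {ρ : Representation ℂ G V}
    (hρ : ρ.IsIrreducible) {h : G} (hq : ∃ q : ℚ, ρ.character h = q)
    (hc : ∀ g, ρ h * ρ g = ρ g * ρ h) : ρ (h ^ 2) = 1 := by
  obtain ⟨a, ha⟩ := hρ.exists_eq_smul (ρ h) fun g v => LinearMap.congr_fun (hc g) v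
  have := hρ.nontrivial
  have h1 : ρ h = a • 1 := by ext v; simp [ha]
  obtain ⟨q, hq⟩ := hq
  have hn : ((Module.finrank ℂ V : ℕ) : ℂ) ≠ 0 := by exact_mod_cast Module.finrank_pos.ne'
  rw [Representation.character, h1, map_smul, LinearMap.trace_one, smul_eq_mul] at hq
  have h2 : a = ((q / Module.finrank ℂ V : ℚ) : ℂ) := by
    push_cast
    exact eq_div_of_mul_eq hn hq
  set r : ℚ := q / Module.finrank ℂ V
  have h3 : a ^ orderOf h = 1 := by
    have h4 : ρ (h ^ orderOf h) = a ^ orderOf h • 1 := by rw [map_pow, h1, smul_pow, one_pow]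
    rw [pow_orderOf_eq_one, map_one] at h4
    obtain ⟨v, hv⟩ := exists_ne (0 : V)
    have h5 := LinearMap.congr_fun h4 v
    simp only [Module.End.one_apply, LinearMap.smul_apply] at h5
    have h6 : (a ^ orderOf h - 1) • v = 0 := by rw [sub_smul, ← h5, one_smul, sub_self]
    exact sub_eq_zero.1 ((smul_eq_zero.1 h6).resolve_right hv)
  have h7 : r ^ orderOf h = 1 := by
    rw [h2] at h3
    exact_mod_cast h3
  have h8 : r ^ 2 = 1 := by
    have habs : |r| = 1 := by
      have := congrArg abs h7
      rw [abs_pow, abs_one] at this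
      exact (pow_eq_one_iff_of_nonneg (abs_nonneg r) (orderOf_pos h).ne').1 this
    rw [← sq_abs, habs, one_pow]
  rw [map_pow, h1, smul_pow, one_pow, h2, ← Rat.cast_pow, h8, Rat.cast_one, one_smul]

/-- An irreducible representation in which all squares act trivially has a linear character. -/
theorem Representation.IsIrreducible.exists_linear {G V : Type*} [Group G]
    [AddCommGroup V] [Module ℂ V] [FiniteDimensional ℂ V] {ρ : Representation ℂ G V}
    (hρ : ρ.IsIrreducible) (hsq : ∀ g, ρ (g ^ 2) = 1) :
    ∃ l : G →* ℂˣ, (∀ g, l (g ^ 2) = 1) ∧ ρ.character = fun g => (l g : ℂ) := by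
  have hinv : ∀ g, ρ g * ρ g = 1 := fun g => by rw [← map_mul, ← sq, hsq]
  have hcomm : ∀ g h, ρ g * ρ h = ρ h * ρ g := by
    intro g h
    have h1 := hinv (g * h)
    rw [map_mul] at h1
    calc ρ g * ρ h = ρ g * (ρ g * ρ h * (ρ g * ρ h)) * ρ h := by rw [h1, mul_one]
      _ = (ρ g * ρ g) * (ρ h * ρ g) * (ρ h * ρ h) := by noncomm_ring
      _ = ρ h * ρ g := by rw [hinv, hinv, one_mul, mul_one]
  choose a ha using fun g => hρ.exists_eq_smul (ρ g) fun k v =>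
    LinearMap.congr_fun (hcomm g k) v
  have := hρ.nontrivial
  obtain ⟨v, hv⟩ := exists_ne (0 : V)
  let U : Subrepresentation ρ := ⟨Submodule.span ℂ {v}, fun g w hw => by
    rw [ha]; exact Submodule.smul_mem _ _ hw⟩
  have hU : U = ⊤ := by
    refine (hρ.eq_bot_or_eq_top U).resolve_left fun h => hv ?_
    have : v ∈ (⊥ : Subrepresentation ρ) := h.le (Submodule.mem_span_singleton_self v)
    exact (Submodule.mem_bot ℂ).1 this
  have hdim : Module.finrank ℂ V = 1 := by
    rw [← finrank_top ℂ V, ← show U.toSubmodule = ⊤ from congrArg Subrepresentation.toSubmodule hU]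
    exact finrank_span_singleton hv
  have hχ : ∀ g, ρ.character g = a g := by
    intro g
    have h1 : ρ g = a g • 1 := by ext w; simp [ha]
    rw [Representation.character, h1, map_smul, LinearMap.trace_one, hdim, Nat.cast_one,
      smul_eq_mul, mul_one]
  have ha1 : a 1 = 1 := by rw [← hχ, Representation.char_one, hdim, Nat.cast_one]
  have hsm : ∀ c d : ℂ, c • v = d • v → c = d := fun c d h =>
    smul_left_injective ℂ hv h
  let l₀ : G →* ℂ :=
    { toFun := a
      map_one' := ha1
      map_mul' := fun g h => by
        apply hsm
        rw [← ha, map_mul, Module.End.mul_apply, ha, ha, smul_smul] }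
  refine ⟨l₀.toHomUnits, fun g => Units.ext ?_, funext fun g => by rw [hχ]; rfl⟩
  change a (g ^ 2) = 1
  apply hsm
  rw [← ha, hsq, one_smul, Module.End.one_apply]

/-- A `G`-invariant sign `μ` of a normal subgroup `P` such that every `g ∉ P` has a conjugate
`g * p` with `μ p ≠ 1` gives a rational irreducible character: a multiple of `μ` on `P`, extended
by zero. It is afforded by any irreducible subrepresentation of the functions `f` on `G` with
`f (x * p) = μ p * f x`. -/
theorem exists_mem_IrrQ_of_invariant {G : Type*} [Group G] [Finite G] (P : Subgroup G) [P.Normal]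
    (μ : P →* ℂˣ) (hsq : ∀ p, μ p ^ 2 = 1)
    (hinv : ∀ (g : G) (p p' : P), (p' : G) = g⁻¹ * p * g → μ p' = μ p)
    (hout : ∀ g ∉ P, ∃ (h : G) (p : P), h * g * h⁻¹ = g * p ∧ μ p ≠ 1) :
    ∃ χ ∈ IrrQ G, ∃ n : ℕ, n ≠ 0 ∧ (∀ p : P, χ p = n * (μ p : ℂ)) ∧ ∀ g ∉ P, χ g = 0 := by
  classical
  let W : Subrepresentation (rightRegular G) :=
    { toSubmodule :=
        { carrier := {f | ∀ (x : G) (p : P), f (x * p) = μ p * f x}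
          add_mem' := fun {f f'} hf hf' x p => by
            rw [Pi.add_apply, Pi.add_apply, hf, hf', mul_add]
          zero_mem' := fun x p => by simp
          smul_mem' := fun c f hf x p => by
            rw [Pi.smul_apply, Pi.smul_apply, hf, smul_eq_mul, smul_eq_mul]; ring }
      apply_mem_toSubmodule := by
        intro g f hf x p
        have hmem : g⁻¹ * p * g ∈ P := by
          simpa using (inferInstance : P.Normal).conj_mem p p.2 g⁻¹
        have h1 := hf (x * g) ⟨g⁻¹ * p * g, hmem⟩
        rw [hinv g p ⟨_, hmem⟩ rfl] at h1
        rw [rightRegular_apply, rightRegular_apply, ← h1]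
        congr 1
        group }
  have hW : W ≠ ⊥ := by
    intro hbot
    let f : G → ℂ := fun x => if hx : x ∈ P then (μ ⟨x, hx⟩ : ℂ) else 0
    have hf : f ∈ W := by
      intro x p
      by_cases hx : x ∈ P
      · have hxp : x * p ∈ P := P.mul_mem hx p.2
        simp only [f, hx, hxp, dif_pos]
        rw [mul_comm, ← Units.val_mul, ← map_mul]
        rfl
      · have hxp : x * p ∉ P := fun h => hx ((P.mul_mem_cancel_right p.2).1 h)
        simp only [f, hx, hxp, dif_neg, not_false_eq_true, mul_zero]
    have h0 : f = 0 := (Submodule.mem_bot ℂ).1 (hbot.le hf)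
    have h1 := congrFun h0 1
    simp only [f, P.one_mem, dif_pos] at h1
    exact Units.ne_zero _ h1
  obtain ⟨U, hUW, hU⟩ := Subrepresentation.exists_irreducible_le hW
  have := hU.nontrivial
  set n := Module.finrank ℂ U.toSubmodule
  have hscal : ∀ p : P, U.toRepresentation p = (μ p : ℂ) • 1 := by
    intro p
    ext v x
    exact hUW v.2 x p
  have hP : ∀ p : P, U.toRepresentation.character p = n * (μ p : ℂ) := by
    intro p
    rw [Representation.character, hscal, map_smul, LinearMap.trace_one, smul_eq_mul, mul_comm]
  have hout' : ∀ g ∉ P, U.toRepresentation.character g = 0 := by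
    intro g hg
    obtain ⟨h, p, hp, hμ⟩ := hout g hg
    have h1 := U.toRepresentation.char_conj g h
    rw [hp, Representation.character, map_mul, hscal, mul_smul_comm, mul_one, map_smul,
      smul_eq_mul] at h1
    have h2 : ((μ p : ℂ) - 1) * U.toRepresentation.character g = 0 := by
      rw [sub_mul, one_mul, sub_eq_zero]
      exact h1
    refine (mul_eq_zero.1 h2).resolve_left fun h3 => hμ (Units.ext ?_)
    simpa using sub_eq_zero.1 h3
  refine ⟨_, ⟨character_mem_Irr _ hU, isRationalChar_iff.2 fun g => ?_⟩, n,
    Module.finrank_pos.ne', hP, hout'⟩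
  by_cases hg : g ∈ P
  · obtain ⟨q, hq⟩ := exists_rat_eq_of_sq_eq_one (z := μ ⟨g, hg⟩)
      (by rw [← Units.val_pow_eq_pow_val, hsq, Units.val_one])
    exact ⟨n * q, by rw [hP ⟨g, hg⟩, hq]; push_cast; rfl⟩
  · exact ⟨0, by rw [hout' g hg, Rat.cast_zero]⟩

/-! ### Squares and powerfully embedded subgroups -/

/-- The subgroup of the elements that are central modulo the normal subgroup `M`. -/
def centralMod {G : Type*} [Group G] (M : Subgroup G) [M.Normal] : Subgroup G :=
  (Subgroup.center (G ⧸ M)).comap (QuotientGroup.mk' M)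

theorem mem_centralMod {G : Type*} [Group G] {M : Subgroup G} [M.Normal] {x : G} :
    x ∈ centralMod M ↔ ∀ g, ⁅x, g⁆ ∈ M := by
  rw [centralMod, Subgroup.mem_comap, Subgroup.mem_center_iff,
    (QuotientGroup.mk'_surjective M).forall]
  refine forall_congr' fun g => ?_
  rw [eq_comm, ← commutatorElement_eq_one_iff_mul_comm, ← map_commutatorElement,
    QuotientGroup.mk'_apply, QuotientGroup.eq_one_iff]

theorem commutator_top_le_iff {G : Type*} [Group G] {H M : Subgroup G} [M.Normal] :
    ⁅H, (⊤ : Subgroup G)⁆ ≤ M ↔ H ≤ centralMod M := by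
  rw [Subgroup.commutator_le]
  exact ⟨fun h x hx => mem_centralMod.2 fun g => h x hx g trivial,
    fun h x hx g _ => mem_centralMod.1 (h hx) g⟩

/-- A normal subgroup of a nilpotent group generated modulo `M` by its commutators with the whole
group lies in `M`. -/
theorem le_of_le_sup_commutator_top {G : Type*} [Group G] [Group.IsNilpotent G]
    {K M : Subgroup G} [K.Normal] [M.Normal] (h : K ≤ M ⊔ ⁅K, (⊤ : Subgroup G)⁆) : K ≤ M := by
  have key : ∀ n, K ≤ M ⊔ (⊤ : Subgroup G).lowerCentralSeries n := by
    intro n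
    induction n with
    | zero => simp
    | succ n ih =>
      refine h.trans (sup_le le_sup_left ?_)
      have : ((⊤ : Subgroup G).lowerCentralSeries n).Normal := inferInstance
      rw [Subgroup.lowerCentralSeries_succ]
      rw [commutator_top_le_iff]
      refine ih.trans (sup_le ?_ ?_)
      · rw [← commutator_top_le_iff]
        exact (Subgroup.commutator_le_left _ _).trans le_sup_left
      · rw [← commutator_top_le_iff]
        exact le_sup_right
  obtain ⟨n, hn⟩ := Subgroup.nilpotent_iff_lowerCentralSeries.1 ‹Group.IsNilpotent G›
  have := key n
  rwa [hn, sup_bot_eq] at this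

/-- The subgroup generated by the squares of the elements of `H`; for a finite `2`-group `H` this is the
Frattini subgroup of `H`. -/
def sqs {G : Type*} [Group G] (H : Subgroup G) : Subgroup G :=
  Subgroup.closure ((fun x => x ^ 2) '' (H : Set G))

theorem sq_mem_sqs {G : Type*} [Group G] {H : Subgroup G} {x : G} (hx : x ∈ H) :
    x ^ 2 ∈ sqs H :=
  Subgroup.subset_closure ⟨x, hx, rfl⟩

theorem sqs_le_iff {G : Type*} [Group G] {H K : Subgroup G} :
    sqs H ≤ K ↔ ∀ x ∈ H, x ^ 2 ∈ K := by
  rw [sqs, Subgroup.closure_le, Set.image_subset_iff]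
  rfl

theorem sqs_le {G : Type*} [Group G] (H : Subgroup G) : sqs H ≤ H :=
  sqs_le_iff.2 fun _ hx => H.pow_mem hx 2

instance sqs_normal {G : Type*} [Group G] (H : Subgroup G) [H.Normal] : (sqs H).Normal := by
  refine ⟨fun x hx g => ?_⟩
  have h : sqs H ≤ (sqs H).comap (MulAut.conj g).toMonoidHom := by
    refine sqs_le_iff.2 fun y hy => ?_
    rw [Subgroup.mem_comap, map_pow]
    exact sq_mem_sqs ((inferInstance : H.Normal).conj_mem y hy g)
  exact h hx

theorem sqs_zpowers {G : Type*} [Group G] (c : G) :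
    sqs (Subgroup.zpowers c) = Subgroup.zpowers (c ^ 2) := by
  refine le_antisymm (sqs_le_iff.2 ?_)
    (Subgroup.zpowers_le.2 (sq_mem_sqs (Subgroup.mem_zpowers c)))
  rintro _ ⟨m, rfl⟩
  exact ⟨m, by change (c ^ 2) ^ m = (c ^ m) ^ 2; group⟩

theorem commutator_le_sqs_top {G : Type*} [Group G] :
    ⁅(⊤ : Subgroup G), (⊤ : Subgroup G)⁆ ≤ sqs ⊤ := by
  rw [commutator_top_le_iff]
  intro x _
  refine mem_centralMod.2 fun g => ?_
  have h : ⁅x, g⁆ = (x * g) ^ 2 * (g⁻¹ * x⁻¹ * g) ^ 2 * g⁻¹ ^ 2 := by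
    simp only [commutatorElement_def, sq]; group
  rw [h]
  exact mul_mem (mul_mem (sq_mem_sqs trivial) (sq_mem_sqs trivial)) (sq_mem_sqs trivial)

/-- In a `2`-group, `x` is a power of each of its odd powers. -/
theorem IsPGroup.mem_zpowers_odd {G : Type*} [Group G] (hG : IsPGroup 2 G) (x : G) {k : ℤ}
    (hk : Odd k) : x ∈ Subgroup.zpowers (x ^ k) := by
  rw [mem_zpowers_zpow_iff, Int.gcd_comm, ← Int.isCoprime_iff_gcd_eq_one]
  obtain ⟨n, hn⟩ := (IsPGroup.iff_orderOf.1 hG) x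
  rw [hn]
  push_cast
  obtain ⟨m, rfl⟩ := hk
  exact IsCoprime.pow_left ⟨-m, 1, by ring⟩

theorem IsPGroup.eq_one_of_zpow_odd {G : Type*} [Group G] (hG : IsPGroup 2 G) {x : G} {k : ℤ}
    (hk : Odd k) (hx : x ^ k = 1) : x = 1 := by
  have := hG.mem_zpowers_odd x hk
  rwa [hx, Subgroup.zpowers_one_eq_bot, Subgroup.mem_bot] at this

/-- The squares of a `2`-group `H` are non-generators: maximal subgroups are normal, and a square
outside one of them would generate its own square root modulo it. -/
theorem eq_of_le_sup_sqs {G : Type*} [Group G] [Finite G] (hG : IsPGroup 2 G) {L H : Subgroup G}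
    (hLH : L ≤ H) (h : H ≤ L ⊔ sqs H) : L = H := by
  by_contra hne
  have hlt : L.subgroupOf H ≠ ⊤ := fun h1 =>
    hne (le_antisymm hLH (Subgroup.subgroupOf_eq_top.1 h1))
  obtain ⟨M, hM, hLM⟩ := (eq_top_or_exists_le_coatom (L.subgroupOf H)).resolve_left hlt
  have : Fact (Nat.Prime 2) := ⟨Nat.prime_two⟩
  have : Group.IsNilpotent H := (hG.to_subgroup H).isNilpotent
  have hMn : M.Normal :=
    Subgroup.NormalizerCondition.normal_of_coatom M Group.normalizerCondition_of_isNilpotent hM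
  have hsq : ∀ x : H, x ^ 2 ∈ M := by
    intro x
    by_contra hx
    have hsup : M ⊔ Subgroup.zpowers (x ^ 2) = ⊤ := by
      refine hM.2 _ (lt_of_le_of_ne le_sup_left fun h1 => hx ?_)
      rw [h1]
      exact Subgroup.mem_sup_right (Subgroup.mem_zpowers _)
    have hxm : x ∈ M ⊔ Subgroup.zpowers (x ^ 2) := hsup ▸ trivial
    obtain ⟨m, hm, _, ⟨k, rfl⟩, hmk⟩ := Subgroup.mem_sup_of_normal_left.1 hxm
    have hodd : x ^ (1 - 2 * k) ∈ M := by
      have : x ^ (1 - 2 * k) = m := by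
        have hmk' : m * (x ^ (2 : ℕ)) ^ k = x := hmk
        rw [zpow_sub, zpow_one, zpow_mul, mul_inv_eq_iff_eq_mul]
        exact_mod_cast hmk'.symm
      exact this ▸ hm
    have hx' := Subgroup.zpowers_le.2 hodd
      ((hG.to_subgroup H).mem_zpowers_odd x (k := 1 - 2 * k) ⟨-k, by ring⟩)
    exact hx (M.pow_mem hx' 2)
  have hle : L ⊔ sqs H ≤ M.map H.subtype := by
    refine sup_le ?_ (sqs_le_iff.2 fun x hx => ⟨⟨x, hx⟩ ^ 2, hsq _, rfl⟩)
    exact fun x hx => ⟨⟨x, hLH hx⟩, hLM hx, rfl⟩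
  refine hM.1 (eq_top_iff.2 fun x _ => ?_)
  obtain ⟨y, hy, hyx⟩ := hle (h x.2)
  rwa [← Subtype.ext hyx]

theorem eq_bot_of_le_sqs {G : Type*} [Group G] [Finite G] (hG : IsPGroup 2 G) {H : Subgroup G}
    (h : H ≤ sqs H) : H = ⊥ :=
  (eq_of_le_sup_sqs hG bot_le (by rwa [bot_sup_eq])).symm

/-- A `2`-group in which the squares generate a subgroup of index two is cyclic. -/
theorem eq_zpowers_of_relIndex_sqs {G : Type*} [Group G] [Finite G] (hG : IsPGroup 2 G)
    {H : Subgroup G} (h : (sqs H).relIndex H = 2) :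
    ∃ c ∈ H, c ∉ sqs H ∧ H = Subgroup.zpowers c := by
  obtain ⟨c, hcH, hc, hcb⟩ := Subgroup.relIndex_eq_two_iff_exists_notMem_and'.1 h
  refine ⟨c, hcH, hc, (eq_of_le_sup_sqs hG (Subgroup.zpowers_le.2 hcH) fun b hb => ?_).symm⟩
  rcases hcb b hb with h1 | h1
  · have : b = c⁻¹ * (c * b) := by group
    rw [this]
    exact Subgroup.mul_mem_sup (inv_mem (Subgroup.mem_zpowers c)) h1
  · exact Subgroup.mem_sup_right h1

/-- A normal subgroup `N` is powerfully embedded if it is central modulo the squares of its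
squares. Taking `sqs (sqs N)` instead of the subgroup generated by the fourth powers of `N` makes the
condition match the series obtained by iterating `sqs`. The notations `N²` and `N⁴` in comments stand
for `sqs N` and `sqs (sqs N)`. -/
structure PowEmb {G : Type*} [Group G] (N : Subgroup G) : Prop where
  normal : N.Normal
  comm_le : ⁅N, (⊤ : Subgroup G)⁆ ≤ sqs (sqs N)

theorem commutator_sqs_le {G : Type*} [Group G] {H A : Subgroup G} [H.Normal] [A.Normal]
    (h : ⁅H, (⊤ : Subgroup G)⁆ ≤ A) :
    ⁅sqs H, (⊤ : Subgroup G)⁆ ≤ sqs A ⊔ ⁅⁅H, (⊤ : Subgroup G)⁆, (⊤ : Subgroup G)⁆ := by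
  rw [commutator_top_le_iff, sqs_le_iff]
  intro x hx
  refine mem_centralMod.2 fun g => ?_
  have hk : ⁅x, g⁆ ∈ ⁅H, (⊤ : Subgroup G)⁆ := Subgroup.commutator_mem_commutator hx trivial
  have h1 : ⁅x ^ 2, g⁆ = ⁅⁅x, g⁆, x⁆⁻¹ * ⁅x, g⁆ ^ 2 := by
    simp only [commutatorElement_def, sq, mul_inv_rev, inv_inv]
    simp only [mul_assoc, inv_mul_cancel_left, mul_inv_cancel_left]
  rw [h1]
  exact mul_mem (Subgroup.mem_sup_right (inv_mem (Subgroup.commutator_mem_commutator hk trivial)))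
    (Subgroup.mem_sup_left (sq_mem_sqs (h hk)))

theorem PowEmb.sqs {G : Type*} [Group G] [Finite G] (hG : IsPGroup 2 G) {N : Subgroup G}
    (hN : PowEmb N) : PowEmb (sqs N) := by
  have := hN.normal
  have : Fact (Nat.Prime 2) := ⟨Nat.prime_two⟩
  have : Group.IsNilpotent G := hG.isNilpotent
  refine ⟨inferInstance, le_of_le_sup_commutator_top ?_⟩
  -- Both `[N², G]` and `[N⁴, G]` are controlled by squares and by iterated commutators.
  have h1 := commutator_sqs_le hN.comm_le
  have h2 := commutator_sqs_le
    ((Subgroup.commutator_mono (sqs_le N) le_rfl).trans hN.comm_le)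
  refine h1.trans (sup_le le_sup_left ?_)
  exact (Subgroup.commutator_mono hN.comm_le le_rfl).trans h2

theorem PowEmb.induction {G : Type*} [Group G] [Finite G] (hG : IsPGroup 2 G)
    {motive : Subgroup G → Prop} (bot : motive ⊥)
    (step : ∀ N, PowEmb N → N ≠ ⊥ → motive (_root_.sqs N) → motive N) {N : Subgroup G}
    (hN : PowEmb N) : motive N := by
  induction N using WellFoundedLT.induction with
  | ind N ih =>
    by_cases h : N = ⊥
    · exact h ▸ bot
    · refine step N hN h (ih _ (lt_of_le_of_ne (sqs_le N) fun h1 => h ?_) (hN.sqs hG))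
      exact eq_bot_of_le_sqs hG h1.ge

/-- The elements of `N` whose squares lie in `sqs (sqs N)`. For powerfully embedded `N` this is the
kernel of the squaring homomorphism `N / N² → N² / N⁴`. -/
theorem PowEmb.exists_sqKer {G : Type*} [Group G] {N : Subgroup G}
    (hN : PowEmb N) : ∃ L : Subgroup G, (∀ x, x ∈ L ↔ x ∈ N ∧ x ^ 2 ∈ _root_.sqs (_root_.sqs N)) ∧
      L.relIndex N = (_root_.sqs (_root_.sqs N)).relIndex (_root_.sqs N) := by
  have := hN.normal
  set S := _root_.sqs (_root_.sqs N)
  have hcomm : ∀ x ∈ N, ∀ y : G, Commute (QuotientGroup.mk' S x) (QuotientGroup.mk' S y) := by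
    intro x hx y
    rw [← commutatorElement_eq_one_iff_commute, ← map_commutatorElement, QuotientGroup.mk'_apply,
      QuotientGroup.eq_one_iff]
    exact hN.comm_le (Subgroup.commutator_mem_commutator hx trivial)
  let φ : N →* G ⧸ S :=
    { toFun := fun x => (QuotientGroup.mk' S x) ^ 2
      map_one' := by simp
      map_mul' := fun x y => by
        rw [Subgroup.coe_mul, map_mul, (hcomm x x.2 y).mul_pow] }
  have hrange : φ.range = (_root_.sqs N).map (QuotientGroup.mk' S) := by
    refine le_antisymm ?_ ?_
    · rintro _ ⟨x, rfl⟩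
      exact ⟨x ^ 2, sq_mem_sqs x.2, map_pow _ _ _⟩
    · rw [Subgroup.map_le_iff_le_comap, sqs_le_iff]
      exact fun x hx => ⟨⟨x, hx⟩, (map_pow _ _ _).symm⟩
  refine ⟨φ.ker.map N.subtype, fun x => ?_, ?_⟩
  · simp only [Subgroup.mem_map, Subgroup.subtype_apply, Subtype.exists, exists_and_right,
      exists_eq_right, MonoidHom.mem_ker]
    have h1 : ∀ hx : x ∈ N, φ ⟨x, hx⟩ = 1 ↔ x ^ 2 ∈ S := fun hx => by
      change (QuotientGroup.mk' S x) ^ 2 = 1 ↔ _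
      rw [← map_pow, QuotientGroup.mk'_apply, QuotientGroup.eq_one_iff]
    exact ⟨fun ⟨hx, h⟩ => ⟨hx, (h1 hx).1 h⟩, fun ⟨hx, h⟩ => ⟨hx, (h1 hx).2 h⟩⟩
  · have h1 : (φ.ker.map N.subtype).subgroupOf N = φ.ker := by
      rw [Subgroup.subgroupOf, Subgroup.comap_map_eq_self_of_injective N.subtype_injective]
    rw [Subgroup.relIndex, h1, Subgroup.index_ker, hrange, ← Subgroup.relIndex_ker,
      QuotientGroup.ker_mk']

/-! ### Rational characters of powerful groups -/

/-- The characters of order at most two of the group `G`. -/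
def signChars (G : Type*) [Group G] : Set (G → ℂ) :=
  {χ | ∃ l : G →* ℂˣ, (∀ g, l (g ^ 2) = 1) ∧ χ = fun g => (l g : ℂ)}

theorem signChars_subset_IrrQ (G : Type*) [Group G] : signChars G ⊆ IrrQ G := by
  rintro _ ⟨l, hl, rfl⟩
  exact linear_mem_IrrQ l hl

theorem exists_hom_units_ne_one {A : Type*} [CommGroup A] [Finite A] {a : A} (ha : a ≠ 1) :
    ∃ φ : A →* ℂˣ, φ a ≠ 1 :=
  have : NeZero (Monoid.exponent A) := ⟨Monoid.exponent_ne_zero_of_finite⟩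
  CommGroup.exists_apply_ne_one_of_hasEnoughRootsOfUnity A ℂ ha

theorem encard_signChars (G : Type*) [Group G] [Finite G] :
    (signChars G).encard = (sqs (⊤ : Subgroup G)).index := by
  let Q := G ⧸ sqs (⊤ : Subgroup G)
  let _ : CommGroup Q :=
    { (inferInstance : Group Q) with
      mul_comm := by
        intro a b
        obtain ⟨x, rfl⟩ := QuotientGroup.mk'_surjective _ a
        obtain ⟨y, rfl⟩ := QuotientGroup.mk'_surjective _ b
        refine commutatorElement_eq_one_iff_mul_comm.1 ?_
        rw [← map_commutatorElement, QuotientGroup.mk'_apply, QuotientGroup.eq_one_iff]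
        exact commutator_le_sqs_top
          (Subgroup.commutator_mem_commutator (Subgroup.mem_top x) (Subgroup.mem_top y)) }
  have : NeZero (Monoid.exponent Q) := ⟨Monoid.exponent_ne_zero_of_finite⟩
  let F : (Q →* ℂˣ) → G → ℂ := fun l g => (l (QuotientGroup.mk' _ g) : ℂ)
  have hF : Function.Injective F := by
    intro l l' h
    refine MonoidHom.ext fun q => Units.ext ?_
    obtain ⟨g, rfl⟩ := QuotientGroup.mk'_surjective _ q
    exact congrFun h g
  have hrange : signChars G = Set.range F := by
    refine Set.Subset.antisymm ?_ ?_
    · rintro _ ⟨l, hl, rfl⟩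
      exact ⟨QuotientGroup.lift _ l (sqs_le_iff.2 fun x _ => hl x), rfl⟩
    · rintro _ ⟨l, rfl⟩
      refine ⟨l.comp (QuotientGroup.mk' _), fun g => ?_, rfl⟩
      have h1 : QuotientGroup.mk' (sqs (⊤ : Subgroup G)) (g ^ 2) = 1 := by
        rw [QuotientGroup.mk'_apply, QuotientGroup.eq_one_iff]
        exact sq_mem_sqs (Subgroup.mem_top g)
      rw [MonoidHom.comp_apply, h1, map_one]
  rw [hrange, ← Set.image_univ, hF.encard_image, Set.encard_univ]
  have hfin : Finite (Q →* ℂˣ) := Nat.finite_of_card_ne_zero (by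
    rw [CommGroup.card_monoidHom_of_hasEnoughRootsOfUnity]
    exact Nat.card_pos.ne')
  rw [ENat.card_eq_coe_natCard, CommGroup.card_monoidHom_of_hasEnoughRootsOfUnity]
  rfl

/-- A rational irreducible representation is trivial on the squares of every powerfully embedded
subgroup `N`: if it is trivial on `N⁴`, then it is central on `N`, hence of values `±1` there. -/
theorem PowEmb.sqs_le_ker {G V : Type*} [Group G] [Finite G] (hG : IsPGroup 2 G)
    [AddCommGroup V] [Module ℂ V] [FiniteDimensional ℂ V] {ρ : Representation ℂ G V}
    (hρ : ρ.IsIrreducible) (hq : IsRationalChar ρ.character) {N : Subgroup G} (hN : PowEmb N) :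
    _root_.sqs N ≤ MonoidHom.ker ρ := by
  refine hN.induction hG (motive := fun N => _root_.sqs N ≤ MonoidHom.ker ρ)
    ((sqs_le _).trans bot_le) fun N hN _ ih => sqs_le_iff.2 fun x hx => ?_
  refine hρ.sq_eq_one_of_rational (isRationalChar_iff.1 hq x) fun g => ?_
  have h1 : ρ ⁅x, g⁆ = 1 := ih (hN.comm_le (Subgroup.commutator_mem_commutator hx
    (Subgroup.mem_top g)))
  have h2 : x * g = ⁅x, g⁆ * (g * x) := by rw [commutatorElement_def]; group
  rw [← map_mul, h2, map_mul, h1, one_mul, map_mul]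

theorem IrrQ_eq_signChars {G : Type*} [Group G] [Finite G] (hG : IsPGroup 2 G)
    (h : PowEmb (⊤ : Subgroup G)) : IrrQ G = signChars G := by
  refine Set.Subset.antisymm ?_ (signChars_subset_IrrQ G)
  rintro _ ⟨⟨n, ρ, hρ, rfl⟩, hq⟩
  exact hρ.exists_linear fun g => h.sqs_le_ker hG hρ hq (sq_mem_sqs (Subgroup.mem_top g))

/-! ### Rational classes of powerful groups -/

/-- The conjugacy classes of the rational elements of `G` that lie in `N`. -/
def ratCl {G : Type*} [Group G] (N : Subgroup G) : Set (ConjClasses G) :=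
  {K | ∃ x ∈ N, IsRationalElement x ∧ ConjClasses.mk x = K}

theorem ratCl_top {G : Type*} [Group G] : ratCl (⊤ : Subgroup G) = clQ G := by
  ext K
  simp [ratCl, clQ]

theorem IsPGroup.exists_mem_zpowers_sq_eq_one {G : Type*} [Group G] [Finite G] (hG : IsPGroup 2 G)
    {c : G} (hc : c ≠ 1) : ∃ z ∈ Subgroup.zpowers c, z ≠ 1 ∧ z ^ 2 = 1 := by
  have : Fact (Nat.Prime 2) := ⟨Nat.prime_two⟩
  have h2 := hG.dvd_orderOf hc
  refine ⟨c ^ (orderOf c / 2), ⟨(orderOf c / 2 : ℕ), zpow_natCast _ _⟩, ?_, ?_⟩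
  · refine pow_ne_one_of_lt_orderOf ?_ ?_
    · have := orderOf_pos c
      omega
    · exact Nat.div_lt_self (orderOf_pos c) one_lt_two
  · rw [← pow_mul, Nat.div_mul_cancel h2, pow_orderOf_eq_one]

theorem eq_of_sq_eq_one_of_mem_zpowers {G : Type*} [Group G] [Finite G] {c v w : G}
    (hv : v ∈ Subgroup.zpowers c) (hw : w ∈ Subgroup.zpowers c) (hv2 : v ^ 2 = 1) (hw2 : w ^ 2 = 1)
    (hv1 : v ≠ 1) (hw1 : w ≠ 1) : v = w := by
  obtain ⟨a, rfl⟩ := hv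
  obtain ⟨b, rfl⟩ := hw
  simp only at *
  rw [← zpow_natCast, ← zpow_mul, ← orderOf_dvd_iff_zpow_eq_one] at hv2 hw2
  rw [Ne, ← orderOf_dvd_iff_zpow_eq_one] at hv1 hw1
  obtain ⟨s, hs⟩ := hv2
  obtain ⟨t, ht⟩ := hw2
  rw [← mul_inv_eq_one, ← zpow_neg, ← zpow_add, ← orderOf_dvd_iff_zpow_eq_one]
  -- Both exponents are odd multiples of half the order.
  rcases Int.even_or_odd' s with ⟨s', rfl | rfl⟩
  · exact absurd ⟨s', by push_cast at hs; linarith⟩ hv1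
  rcases Int.even_or_odd' t with ⟨t', rfl | rfl⟩
  · exact absurd ⟨t', by push_cast at ht; linarith⟩ hw1
  exact ⟨s' - t', by push_cast at hs ht; linarith⟩

/-- Let `C = ⟨c⟩` be a cyclic subgroup on which `G` acts by powers with exponents `≡ 1 mod 4`, and let
`x` be such that the commutators of `G` with the elements of the coset `C * x`, and the square of
`x`, lie in `C²`. Then exactly two classes of rational elements meet `C * x`. The condition on `x²`
provides an involution `u` in the coset, and `v * u` can be conjugate to its inverse only if an odd
power of `v ^ 2` is the inverse of a commutator with `u`; these commutators have order at most two. -/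
theorem exists_two_rational_classes {G : Type*} [Group G] [Finite G] (hG : IsPGroup 2 G) {c x : G}
    (hc1 : c ≠ 1) (hc : ∀ g : G, ⁅g, c⁆ ∈ Subgroup.zpowers (c ^ 4))
    (hx : ∀ y ∈ Subgroup.zpowers c, ∀ g : G, ⁅g, y * x⁆ ∈ Subgroup.zpowers (c ^ 2))
    (hx2 : x ^ 2 ∈ Subgroup.zpowers (c ^ 2)) :
    ∃ a ∈ Subgroup.zpowers c, ∃ b ∈ Subgroup.zpowers c,
      IsRationalElement (a * x) ∧ IsRationalElement (b * x) ∧ ¬ IsConj (a * x) (b * x) ∧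
      ∀ v ∈ Subgroup.zpowers c, IsRationalElement (v * x) →
        IsConj (v * x) (a * x) ∨ IsConj (v * x) (b * x) := by
  -- the action of `g` on the cyclic group
  have hact : ∀ g : G, ∃ k : ℤ, ∀ v ∈ Subgroup.zpowers c, g * v * g⁻¹ = v ^ (1 + 4 * k) := by
    intro g
    obtain ⟨k, hk⟩ := hc g
    have hk' : (c ^ 4) ^ k = g * c * g⁻¹ * c⁻¹ := hk
    refine ⟨k, ?_⟩
    rintro _ ⟨m, rfl⟩
    have h1 : g * c * g⁻¹ = c ^ (1 + 4 * k) := by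
      rw [add_comm, zpow_add, zpow_mul, zpow_one, ← mul_inv_eq_iff_eq_mul, ← hk']
      norm_cast
    change g * c ^ m * g⁻¹ = (c ^ m) ^ (1 + 4 * k)
    rw [← conj_zpow, h1, ← zpow_mul, ← zpow_mul, mul_comm]
  -- replace `x` by an involution `u` of the same coset
  obtain ⟨j, hj⟩ : ∃ j : ℤ, (c ^ j * x) ^ 2 = 1 := by
    obtain ⟨m, hm⟩ := hx2
    have hm' : x ^ 2 = c ^ (2 * m) := by
      have hm0 : (c ^ 2) ^ m = x ^ 2 := hm
      rw [zpow_mul, ← hm0]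
      norm_cast
    obtain ⟨k, hk⟩ := hact x
    obtain ⟨t, ht⟩ := hG.mem_zpowers_odd c (k := 1 + 2 * k) ⟨k, by ring⟩
    have ht' : c ^ ((1 + 2 * k) * t) = c := by rw [zpow_mul]; exact ht
    refine ⟨-(t * m), ?_⟩
    have h1 : (c ^ (-(t * m)) * x) ^ 2
        = c ^ (-(t * m)) * (x * c ^ (-(t * m)) * x⁻¹) * x ^ 2 := by
      simp only [sq]; group
    rw [h1, hk _ ⟨_, rfl⟩, hm', ← zpow_mul, ← zpow_add, ← zpow_add]
    have h2 : -(t * m) + -(t * m) * (1 + 4 * k) + 2 * m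
        = ((1 + 2 * k) * t) * (-(2 * m)) + 2 * m := by ring
    rw [h2, zpow_add, zpow_mul, ht', ← zpow_add, neg_add_cancel, zpow_zero]
  obtain ⟨u, hu⟩ : ∃ u, u = c ^ j * x := ⟨_, rfl⟩
  rw [← hu] at hj
  have hsqz : ∀ v ∈ Subgroup.zpowers (c ^ 2), ∃ w ∈ Subgroup.zpowers c, w ^ 2 = v := by
    rintro _ ⟨m, rfl⟩
    exact ⟨c ^ m, ⟨m, rfl⟩, by change (c ^ m) ^ 2 = (c ^ 2) ^ m; group⟩
  have hle : Subgroup.zpowers (c ^ 2) ≤ Subgroup.zpowers c :=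
    Subgroup.zpowers_le.2 (Subgroup.pow_mem _ (Subgroup.mem_zpowers c) 2)
  have hcu : ∀ v, v * x = (v * c ^ (-j)) * u := fun v => by rw [hu]; group
  have huu : ∀ v, v * u = (v * c ^ j) * x := fun v => by rw [hu]; group
  have hcomm : ∀ g : G, ⁅g, u⁆ ∈ Subgroup.zpowers (c ^ 2) := hu ▸ hx _ ⟨j, rfl⟩
  have hu1 : u⁻¹ = u := by rw [inv_eq_iff_mul_eq_one, ← sq, hj]
  -- commutators with `u` are of order at most two
  have hcomm2 : ∀ g : G, ⁅g, u⁆ ^ 2 = 1 := by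
    intro g
    obtain ⟨k, hk⟩ := hact u
    have h1 : (⁅g, u⁆ * u) ^ 2 = 1 := by
      have : ⁅g, u⁆ * u = g * u * g⁻¹ := by rw [commutatorElement_def]; group
      rw [this, conj_pow, hj, mul_one, mul_inv_cancel]
    have h2 : (⁅g, u⁆ * u) ^ 2 = ⁅g, u⁆ * (u * ⁅g, u⁆ * u⁻¹) * u ^ 2 := by
      simp only [sq, mul_assoc, inv_mul_cancel_left]
    rw [h2, hk _ (hle (hcomm g)), hj, mul_one, ← zpow_one_add] at h1
    refine hG.eq_one_of_zpow_odd (k := 1 + 2 * k) ⟨k, by ring⟩ ?_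
    rw [← zpow_natCast, ← zpow_mul]
    convert h1 using 2
    push_cast
    ring
  have hconj : ∀ g : G, ∃ k : ℤ, ∀ v ∈ Subgroup.zpowers c,
      g * (v * u) * g⁻¹ = v ^ (1 + 4 * k) * (⁅g, u⁆ * u) := by
    intro g
    obtain ⟨k, hk⟩ := hact g
    refine ⟨k, fun v hv => ?_⟩
    rw [← hk v hv, commutatorElement_def]
    group
  -- a rational element `v * u` is conjugate to its inverse, so that `v ^ (2 * odd)` is inverse
  -- to some commutator `⁅g, u⁆`
  have hrat : ∀ v ∈ Subgroup.zpowers c, IsRationalElement (v * u) →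
      ∃ (g : G) (k : ℤ), v ^ (2 * (1 + 2 * k)) * ⁅g, u⁆ = 1 := by
    intro v hv hvr
    obtain ⟨g, hg⟩ := isConj_iff.1 hvr.isConj_inv
    obtain ⟨k, hk⟩ := hconj g
    obtain ⟨l, hl⟩ := hact u
    refine ⟨g, k + l, ?_⟩
    have h1 : (v * u)⁻¹ = (v ^ (1 + 4 * l))⁻¹ * u := by
      have h0 : (u * v * u⁻¹)⁻¹ * u = u * v⁻¹ := by group
      rw [← hl v hv, h0, mul_inv_rev, hu1]
    rw [hk v hv, h1, ← mul_assoc, mul_left_inj, ← mul_eq_one_iff_eq_inv'] at hg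
    have h2 : v ^ (2 * (1 + 2 * (k + l))) = v ^ (1 + 4 * l) * v ^ (1 + 4 * k) := by
      rw [← zpow_add]; congr 1; ring
    rw [h2, mul_assoc, hg]
  suffices ∃ a ∈ Subgroup.zpowers c, ∃ b ∈ Subgroup.zpowers c,
      IsRationalElement (a * u) ∧ IsRationalElement (b * u) ∧ ¬ IsConj (a * u) (b * u) ∧
      ∀ v ∈ Subgroup.zpowers c, IsRationalElement (v * u) →
        IsConj (v * u) (a * u) ∨ IsConj (v * u) (b * u) by
    obtain ⟨a, ha, b, hb, h1, h2, h3, h4⟩ := this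
    have hcj : ∀ i : ℤ, c ^ i ∈ Subgroup.zpowers c := fun i => ⟨i, rfl⟩
    refine ⟨_, mul_mem ha (hcj j), _, mul_mem hb (hcj j), ?_⟩
    rw [← huu, ← huu]
    refine ⟨h1, h2, h3, fun v hv hvr => ?_⟩
    rw [hcu] at hvr ⊢
    exact h4 _ (mul_mem hv (hcj _)) hvr
  by_cases hcent : ∀ g : G, ⁅g, u⁆ = 1
  · -- `u` is central: the two classes are those of `u` and of `z * u`, where `z ∈ C` has order two
    obtain ⟨z, hz, hz1, hz2⟩ : ∃ z ∈ Subgroup.zpowers c, z ≠ 1 ∧ z ^ 2 = 1 :=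
      hG.exists_mem_zpowers_sq_eq_one hc1
    refine ⟨1, one_mem _, z, hz, ?_, ?_, ?_, ?_⟩
    · rw [one_mul]; exact isRationalElement_of_sq hj
    · refine isRationalElement_of_sq ?_
      have hcm : Commute z u := commutatorElement_eq_one_iff_commute.1 (hcent z)
      rw [hcm.mul_pow, hz2, hj, one_mul]
    · rw [one_mul, isConj_iff]
      rintro ⟨g, hg⟩
      have h1 : g * u = u * g := commutatorElement_eq_one_iff_mul_comm.1 (hcent g)
      rw [h1, mul_inv_cancel_right] at hg
      exact hz1 (by simpa using hg)
    · intro v hv hvr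
      obtain ⟨g, k, hgk⟩ := hrat v hv hvr
      rw [hcent, mul_one, zpow_mul] at hgk
      have hv2 : v ^ 2 = 1 := 
        hG.eq_one_of_zpow_odd (k := 1 + 2 * k) ⟨k, by ring⟩ (by exact_mod_cast hgk)
      by_cases hv1 : v = 1
      · left; rw [hv1]
      · right; rw [eq_of_sq_eq_one_of_mem_zpowers hv hz hv2 hz2 hv1 hz1]
  · -- `u` is not central: the two classes are those of `u` and of `w * u`, where `w ∈ C` has
    -- order four
    push Not at hcent
    obtain ⟨g₀, hg₀⟩ := hcent
    obtain ⟨w, hw, hwz⟩ := hsqz _ (hcomm g₀)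
    have hz2 := hcomm2 g₀
    have hzC := hle (hcomm g₀)
    set z := ⁅g₀, u⁆ with hz
    have hw4 : w ^ (4 : ℤ) = 1 := by
      have : w ^ 4 = 1 := by rw [show 4 = 2 * 2 from rfl, pow_mul, hwz, hz2]
      exact_mod_cast this
    have hwact : ∀ k : ℤ, w ^ (1 + 4 * k) = w := fun k => by
      rw [zpow_add, zpow_mul, hw4, one_zpow, mul_one, zpow_one]
    have hzact : ∀ k : ℤ, z ^ (1 + 4 * k) = z := fun k => by
      rw [← hwz, ← zpow_natCast, ← zpow_mul, mul_comm, zpow_mul, hwact]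
    have hwinv : w⁻¹ = w * z := by
      rw [inv_eq_iff_mul_eq_one, ← mul_assoc, ← sq, hwz, ← sq, hz2]
    have hwu : w * u = u * w := by
      obtain ⟨k, hk⟩ := hact u
      have := hk w hw
      rw [hwact, mul_inv_eq_iff_eq_mul] at this
      exact this.symm
    have hconj₀ : ∀ v ∈ Subgroup.zpowers c, v ^ (4 : ℤ) = 1 → IsConj (v * u) (v * z * u) := by
      intro v hv hv4
      obtain ⟨k, hk⟩ := hconj g₀
      refine isConj_iff.2 ⟨g₀, ?_⟩
      rw [hk v hv, zpow_add, zpow_mul, hv4, one_zpow, mul_one, zpow_one, mul_assoc]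
    refine ⟨1, one_mem _, w, hw, ?_, ?_, ?_, ?_⟩
    · rw [one_mul]; exact isRationalElement_of_sq hj
    · refine isRationalElement_of_pow_four ?_ ?_
      · have hcm : Commute w u := hwu
        rw [hcm.mul_pow, show 4 = 2 * 2 from rfl, pow_mul, hwz, hz2, pow_mul u, hj, one_pow,
          one_mul]
      · have h1 : (w * u)⁻¹ = w * z * u := by
          rw [hwu, mul_inv_rev, hu1, hwinv]
        rw [h1]
        exact hconj₀ w hw hw4
    · rw [one_mul, isConj_iff]
      rintro ⟨g, hg⟩
      have h1 : w = ⁅g, u⁆ := by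
        rw [commutatorElement_def, hg, mul_inv_cancel_right]
      exact hg₀ (by rw [← hwz, h1, hcomm2])
    · intro v hv hvr
      obtain ⟨g, k, hgk⟩ := hrat v hv hvr
      have hv4 : v ^ 4 = 1 := by
        refine hG.eq_one_of_zpow_odd (k := 1 + 2 * k) ⟨k, by ring⟩ ?_
        have h1 : v ^ (2 * (1 + 2 * k)) = ⁅g, u⁆⁻¹ := eq_inv_of_mul_eq_one_left hgk
        have h2 : (v ^ 4) ^ (1 + 2 * k) = (v ^ (2 * (1 + 2 * k))) ^ 2 := by
          rw [← zpow_natCast, ← zpow_natCast, ← zpow_mul, ← zpow_mul]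
          congr 1; push_cast; ring
        rw [h2, h1, inv_pow, hcomm2, inv_one]
      have hv22 : (v ^ 2) ^ 2 = 1 := by rw [← pow_mul]; exact hv4
      by_cases hv2 : v ^ 2 = 1
      · left
        by_cases hv1 : v = 1
        · rw [hv1]
        · rw [eq_of_sq_eq_one_of_mem_zpowers hv hzC hv2 hz2 hv1 hg₀]
          have := hconj₀ 1 (one_mem _) (one_zpow _)
          rw [one_mul z] at this
          exact this.symm
      · right
        have h1 : v ^ 2 = z :=
          eq_of_sq_eq_one_of_mem_zpowers (Subgroup.pow_mem _ hv 2) hzC hv22 hz2 hv2 hg₀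
        by_cases hvw : v = w
        · rw [hvw]
        · have hcm : Commute v w⁻¹ := by
            obtain ⟨i, rfl⟩ := hv
            obtain ⟨l, rfl⟩ := hw
            exact ((Commute.refl c).zpow_zpow i l).inv_right
          have h2 : (v * w⁻¹) ^ 2 = 1 := by rw [hcm.mul_pow, inv_pow, hwz, h1, mul_inv_cancel]
          have h3 : v * w⁻¹ = z := eq_of_sq_eq_one_of_mem_zpowers (mul_mem hv (inv_mem hw)) hzC h2
            hz2 (fun h => hvw (mul_inv_eq_one.1 h)) hg₀
          have h4 : v = w * z := by
            rw [hcm.eq] at h3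
            rw [← h3, mul_inv_cancel_left]
          rw [h4]
          exact (hconj₀ w hw hw4).symm

theorem PowEmb.sq_mem_of_isRationalElement {G : Type*} [Group G] [Finite G] {N : Subgroup G}
    (hN : PowEmb N) {x : G} (hx : x ∈ N) (hr : IsRationalElement x) :
    x ^ 2 ∈ _root_.sqs (_root_.sqs N) := by
  obtain ⟨g, hg⟩ := isConj_iff.1 hr.isConj_inv
  have h1 : ⁅x, g⁆ = x ^ 2 := by
    have h2 : ⁅x, g⁆ = x * (g * x * g⁻¹)⁻¹ := by rw [commutatorElement_def]; group
    rw [h2, hg, inv_inv, sq]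
  rw [← h1]
  exact hN.comm_le (Subgroup.commutator_mem_commutator hx (Subgroup.mem_top g))

theorem mk_notMem_ratCl {G : Type*} [Group G] {C : Subgroup G} [C.Normal] {y : G} (hy : y ∉ C) :
    ConjClasses.mk y ∉ ratCl C := by
  rintro ⟨x, hx, -, h⟩
  obtain ⟨g, rfl⟩ := isConj_iff.1 (ConjClasses.mk_eq_mk_iff_isConj.1 h)
  exact hy ((inferInstance : C.Normal).conj_mem x hx g)

/-- A powerfully embedded subgroup `N` with `|N : N²| ≤ 4` meets exactly `|N : N²|` classes of
rational elements. By induction this holds for `N²`. Rational elements of `N` have squares in `N⁴`,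
hence they lie in `N²` if squaring `N / N² → N² / N⁴` is injective; otherwise either `N² = 1`, or
`N²` is cyclic and they lie in `N²` and one further coset of it. -/
theorem PowEmb.encard_ratCl {G : Type*} [Group G] [Finite G] (hG : IsPGroup 2 G) {N : Subgroup G}
    (hN : PowEmb N) (h4 : (_root_.sqs N).relIndex N ≤ 4) :
    (ratCl N).encard = (_root_.sqs N).relIndex N := by
  revert h4
  refine hN.induction hG (motive := fun N => (_root_.sqs N).relIndex N ≤ 4 →
    (ratCl N).encard = (_root_.sqs N).relIndex N) ?_ ?_
  · intro _
    have h1 : ratCl (⊥ : Subgroup G) = {ConjClasses.mk 1} := by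
      ext K
      constructor
      · rintro ⟨x, hx, -, rfl⟩
        rw [(Subgroup.mem_bot).1 hx]; rfl
      · rintro rfl
        exact ⟨1, one_mem _, isRationalElement_of_sq (one_pow 2), rfl⟩
    rw [h1, Set.encard_singleton, Subgroup.relIndex_bot_right]
    rfl
  intro N hN _ ih hq
  have := hN.normal
  obtain ⟨L, hL, hLN⟩ := hN.exists_sqKer
  have hratL : ∀ x ∈ N, IsRationalElement x → x ∈ L := fun x hx hr =>
    (hL x).2 ⟨hx, hN.sq_mem_of_isRationalElement hx hr⟩
  have hCL : _root_.sqs N ≤ L := fun x hx => (hL x).2 ⟨sqs_le N hx, sq_mem_sqs hx⟩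
  have hmul := Subgroup.relIndex_mul_relIndex _ _ _ hCL fun x hx => ((hL x).1 hx).1
  rw [hLN] at hmul
  have hpos : 0 < (_root_.sqs N).relIndex L :=
    Nat.pos_of_ne_zero (Subgroup.index_ne_zero_of_finite)
  have hpos' : 0 < (_root_.sqs (_root_.sqs N)).relIndex (_root_.sqs N) :=
    Nat.pos_of_ne_zero (Subgroup.index_ne_zero_of_finite)
  rcases Nat.lt_or_ge ((_root_.sqs N).relIndex L) 2 with hi | hi
  · -- squaring is injective
    have hi1 : (_root_.sqs N).relIndex L = 1 := by omega
    rw [hi1, one_mul] at hmul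
    have hLC := Subgroup.relIndex_eq_one.1 hi1
    rw [← hmul, ← ih (hmul.trans_le hq)]
    congr 1
    ext K
    constructor
    · rintro ⟨x, hx, hr, rfl⟩
      exact ⟨x, hLC (hratL x hx hr), hr, rfl⟩
    · rintro ⟨x, hx, hr, rfl⟩
      exact ⟨x, sqs_le N hx, hr, rfl⟩
  rcases Nat.lt_or_ge ((_root_.sqs (_root_.sqs N)).relIndex (_root_.sqs N)) 2 with hj | hj
  · -- `N` is central and elementary abelian
    have hC : _root_.sqs N = ⊥ := eq_bot_of_le_sqs hG (Subgroup.relIndex_eq_one.1 (by omega))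
    have hSS : _root_.sqs (⊥ : Subgroup G) = ⊥ := le_bot_iff.1 (sqs_le _)
    have hcent : ∀ x ∈ N, ∀ g, Commute x g := by
      intro x hx g
      have := hN.comm_le (Subgroup.commutator_mem_commutator hx (Subgroup.mem_top g))
      rw [hC, hSS, Subgroup.mem_bot] at this
      exact commutatorElement_eq_one_iff_commute.1 this
    have h1 : ratCl N = ConjClasses.mk '' (N : Set G) := by
      ext K
      constructor
      · rintro ⟨x, hx, -, rfl⟩
        exact ⟨x, hx, rfl⟩
      · rintro ⟨x, hx, rfl⟩
        refine ⟨x, hx, isRationalElement_of_sq ?_, rfl⟩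
        have := sq_mem_sqs hx
        rwa [hC, Subgroup.mem_bot] at this
    have h2 : Set.InjOn ConjClasses.mk (N : Set G) := by
      intro x hx y hy hxy
      obtain ⟨g, rfl⟩ := isConj_iff.1 (ConjClasses.mk_eq_mk_iff_isConj.1 hxy)
      rw [← (hcent x hx g).eq, mul_inv_cancel_right]
    rw [h1, h2.encard_image, hC, Subgroup.relIndex_bot_left,
      ← (Set.toFinite (N : Set G)).cast_ncard_eq, ← Nat.card_coe_set_eq]
    rfl
  have hle2 : (_root_.sqs N).relIndex L = 2 ∧
      (_root_.sqs (_root_.sqs N)).relIndex (_root_.sqs N) = 2 := by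
    constructor <;> nlinarith
  obtain ⟨hi2, hj2⟩ := hle2
  obtain ⟨c, -, hc, hcC⟩ := eq_zpowers_of_relIndex_sqs hG hj2
  obtain ⟨x, hxL, hxC, hxb⟩ := Subgroup.relIndex_eq_two_iff_exists_notMem_and.1 hi2
  have hS : _root_.sqs (_root_.sqs N) = Subgroup.zpowers (c ^ 2) := by rw [hcC, sqs_zpowers]
  have hSS : _root_.sqs (_root_.sqs (_root_.sqs N)) = Subgroup.zpowers (c ^ 4) := by
    rw [hS, sqs_zpowers, ← pow_mul]
  have hcN : c ∈ _root_.sqs N := hcC ▸ Subgroup.mem_zpowers c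
  have hxN := ((hL x).1 hxL).1
  have hcomm : ∀ {H M : Subgroup G}, ⁅H, (⊤ : Subgroup G)⁆ ≤ M → ∀ y ∈ H, ∀ g : G, ⁅g, y⁆ ∈ M := by
    intro H M h y hy g
    rw [← commutatorElement_inv]
    exact inv_mem (h (Subgroup.commutator_mem_commutator hy (Subgroup.mem_top g)))
  obtain ⟨a, ha, b, hb, hra, hrb, hab, hrat⟩ := exists_two_rational_classes hG (c := c) (x := x)
    (fun h => hc (h ▸ one_mem _)) (fun g => hSS ▸ hcomm (hN.sqs hG).comm_le c hcN g)
    (fun y hy g => hS ▸ hcomm hN.comm_le _ (mul_mem (sqs_le N (hcC ▸ hy)) hxN) g)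
    (hS ▸ ((hL x).1 hxL).2)
  rw [← hcC] at ha hb hrat
  have hout : ∀ v ∈ _root_.sqs N, v * x ∉ _root_.sqs N := fun v hv h =>
    hxC ((Subgroup.mul_mem_cancel_left _ hv).1 h)
  have h1 : ratCl N = insert (ConjClasses.mk (a * x))
      (insert (ConjClasses.mk (b * x)) (ratCl (_root_.sqs N))) := by
    ext K
    constructor
    · rintro ⟨y, hy, hr, rfl⟩
      by_cases hyC : y ∈ _root_.sqs N
      · exact Or.inr (Or.inr ⟨y, hyC, hr, rfl⟩)
      · have hyx := (hxb y (hratL y hy hr)).resolve_right hyC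
        have h2 : y = y * x * (x ^ 2)⁻¹ * x := by rw [sq]; group
        rw [h2] at hr ⊢
        rcases hrat _ (mul_mem hyx (inv_mem (sq_mem_sqs hxN))) hr with h | h
        · exact Or.inl (ConjClasses.mk_eq_mk_iff_isConj.2 h)
        · exact Or.inr (Or.inl (ConjClasses.mk_eq_mk_iff_isConj.2 h))
    · rintro (rfl | rfl | ⟨y, hy, hr, rfl⟩)
      · exact ⟨_, mul_mem (sqs_le N ha) hxN, hra, rfl⟩
      · exact ⟨_, mul_mem (sqs_le N hb) hxN, hrb, rfl⟩
      · exact ⟨y, sqs_le N hy, hr, rfl⟩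
  rw [h1, Set.encard_insert_of_notMem, Set.encard_insert_of_notMem, ih (by omega), ← hmul, hi2, hj2]
  · norm_num
  · exact mk_notMem_ratCl (hout b hb)
  · rintro (h | h)
    · exact hab (ConjClasses.mk_eq_mk_iff_isConj.1 h)
    · exact mk_notMem_ratCl (hout a ha) h

theorem encard_clQ_of_powEmb {G : Type*} [Group G] [Finite G] (hG : IsPGroup 2 G)
    (h : PowEmb (⊤ : Subgroup G)) (h4 : (sqs (⊤ : Subgroup G)).index ≤ 4) :
    (clQ G).encard = (IrrQ G).encard := by
  rw [IrrQ_eq_signChars hG h, encard_signChars, ← ratCl_top, ← Subgroup.relIndex_top_right]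
  rw [← Subgroup.relIndex_top_right] at h4
  exact h.encard_ratCl hG h4

/-! ### Groups that are not powerful -/

/-- Signs separate the points of `H` modulo a normal subgroup containing the squares of `H`. -/
theorem exists_sign {G : Type*} [Group G] [Finite G] {H K : Subgroup G} [K.Normal]
    (hHK : sqs H ≤ K) {z : H} (hzK : (z : G) ∉ K) :
    ∃ μ : H →* ℂˣ, (∀ p, μ p ^ 2 = 1) ∧ (∀ p : H, (p : G) ∈ K → μ p = 1) ∧ μ z ≠ 1 := by
  let Q := H ⧸ K.subgroupOf H
  have hsq : ∀ x : H, QuotientGroup.mk' (K.subgroupOf H) x ^ 2 = 1 := by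
    intro x
    rw [← map_pow, QuotientGroup.mk'_apply, QuotientGroup.eq_one_iff]
    exact hHK (sq_mem_sqs x.2)
  let _ : CommGroup Q :=
    { (inferInstance : Group Q) with
      mul_comm := by
        have hinv : ∀ q : Q, q⁻¹ = q := by
          intro q
          obtain ⟨x, rfl⟩ := QuotientGroup.mk'_surjective _ q
          rw [inv_eq_iff_mul_eq_one, ← sq, hsq]
        intro a b
        rw [← hinv (a * b), mul_inv_rev, hinv, hinv] }
  have hz : QuotientGroup.mk' (K.subgroupOf H) z ≠ 1 := by
    rw [QuotientGroup.mk'_apply, Ne, QuotientGroup.eq_one_iff]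
    exact hzK
  obtain ⟨φ, hφ⟩ := exists_hom_units_ne_one (A := Q) hz
  refine ⟨φ.comp (QuotientGroup.mk' _), fun p => ?_, fun p hp => ?_, hφ⟩
  · rw [MonoidHom.comp_apply, ← map_pow, hsq, map_one]
  · have h1 : QuotientGroup.mk' (K.subgroupOf H) p = 1 := by
      rw [QuotientGroup.mk'_apply, QuotientGroup.eq_one_iff]
      exact hp
    rw [MonoidHom.comp_apply, h1, map_one]

/-- If the elements central modulo `K` form a subgroup of index at most two, then `G / K` is
abelian. -/
theorem commutator_le_of_index_centralMod_le_two {G : Type*} [Group G] [Finite G] {K : Subgroup G}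
    [K.Normal] (h : (centralMod K).index ≤ 2) : ⁅(⊤ : Subgroup G), (⊤ : Subgroup G)⁆ ≤ K := by
  rw [commutator_top_le_iff, top_le_iff, ← Subgroup.index_eq_one]
  by_contra h1
  have h0 : (centralMod K).index ≠ 0 := Subgroup.index_ne_zero_of_finite
  have h2 : (centralMod K).index = 2 := by omega
  obtain ⟨a, ha, hab⟩ := Subgroup.index_eq_two_iff_exists_notMem_and'.1 h2
  refine ha (mem_centralMod.2 fun g => ?_)
  rcases hab g with hg | hg
  · have h3 : ⁅a, g⁆ = ⁅a * g, a⁻¹⁆ := by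
      simp only [commutatorElement_def]; group
    rw [h3]
    exact mem_centralMod.1 hg a⁻¹
  · rw [← commutatorElement_inv]
    exact inv_mem (mem_centralMod.1 hg a)

/-- Let `Φ = sqs ⊤` have index at most five. A sign of `Φ` that is trivial on `[Φ, G]` and nontrivial
on `G'` has a multiple that, extended by zero, is a rational irreducible character. Indeed an element
`g ∉ Φ` whose commutators all lie in the kernel of the sign would generate with `Φ` a subgroup of
index at most two that is central modulo this kernel, and `G'` would be contained in the kernel. The
same argument shows that the index of `Φ` exceeds two. -/
theorem exists_mem_IrrQ_of_sign {G : Type*} [Group G] [Finite G] {Φ : Subgroup G}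
    (hΦ : Φ = sqs ⊤) (hind : Φ.index ≤ 5) (μ : Φ →* ℂˣ) (hsq : ∀ p, μ p ^ 2 = 1)
    (hinv : ∀ p : Φ, (p : G) ∈ ⁅Φ, (⊤ : Subgroup G)⁆ → μ p = 1)
    (hne : ∃ p : Φ, (p : G) ∈ ⁅(⊤ : Subgroup G), (⊤ : Subgroup G)⁆ ∧ μ p ≠ 1) :
    2 < Φ.index ∧ ∃ χ ∈ IrrQ G, ∃ n : ℕ, n ≠ 0 ∧ (∀ p : Φ, χ p = n * (μ p : ℂ)) ∧
      ∀ g ∉ Φ, χ g = 0 := by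
  have hΦn : Φ.Normal := hΦ ▸ inferInstance
  have hinv' : ∀ (g : G) (p p' : Φ), (p' : G) = g⁻¹ * p * g → μ p' = μ p := by
    intro g p p' h
    have h1 : μ (p' * p⁻¹) = 1 := by
      refine hinv _ ?_
      have h2 : ((p' * p⁻¹ : Φ) : G) = ⁅(p : G), g⁻¹⁆⁻¹ := by
        rw [Subgroup.coe_mul, Subgroup.coe_inv, h, commutatorElement_def]; group
      rw [h2]
      exact inv_mem (Subgroup.commutator_mem_commutator p.2 (Subgroup.mem_top _))
    rwa [map_mul, map_inv, mul_inv_eq_one] at h1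
  have hK : (μ.ker.map Φ.subtype).Normal := by
    refine ⟨?_⟩
    rintro _ ⟨p, hp, rfl⟩ g
    have hmem : g * (p : G) * g⁻¹ ∈ Φ := (inferInstance : Φ.Normal).conj_mem p p.2 g
    refine ⟨⟨_, hmem⟩, ?_, rfl⟩
    have := hinv' g⁻¹ p ⟨_, hmem⟩ (by rw [inv_inv])
    rw [SetLike.mem_coe, MonoidHom.mem_ker] at hp ⊢
    rw [this, hp]
  have hKmem : ∀ p : Φ, (p : G) ∈ μ.ker.map Φ.subtype ↔ μ p = 1 := by
    intro p
    constructor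
    · rintro ⟨p', hp', h⟩
      rwa [← Subtype.ext (a1 := p') h]
    · exact fun h => ⟨p, h, rfl⟩
  have hZ : 2 < (centralMod (μ.ker.map Φ.subtype)).index := by
    by_contra h
    obtain ⟨p, hp, hp1⟩ := hne
    exact hp1 ((hKmem p).1 (commutator_le_of_index_centralMod_le_two (not_lt.1 h) hp))
  have hΦZ : Φ ≤ centralMod (μ.ker.map Φ.subtype) := by
    rw [← commutator_top_le_iff]
    intro x hx
    have hxΦ : x ∈ Φ := Subgroup.commutator_le_left Φ ⊤ hx
    exact (hKmem ⟨x, hxΦ⟩).2 (hinv _ hx)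
  have hmul := Subgroup.relIndex_mul_index hΦZ
  have hpos : Φ.relIndex (centralMod (μ.ker.map Φ.subtype)) ≠ 0 :=
    Subgroup.index_ne_zero_of_finite
  refine ⟨by nlinarith [Nat.pos_of_ne_zero hpos], exists_mem_IrrQ_of_invariant Φ μ hsq hinv' ?_⟩
  intro g hg
  by_contra hcon
  push Not at hcon
  -- otherwise `g` is central modulo the kernel of `μ`, and so are all elements
  have hgZ : g⁻¹ ∈ centralMod (μ.ker.map Φ.subtype) := by
    refine mem_centralMod.2 fun h => ?_
    have hmem : ⁅g⁻¹, h⁆ ∈ Φ := hΦ ▸ commutator_le_sqs_top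
      (Subgroup.commutator_mem_commutator (Subgroup.mem_top _) (Subgroup.mem_top _))
    refine (hKmem ⟨_, hmem⟩).2 (hcon h ⟨_, hmem⟩ ?_)
    change h * g * h⁻¹ = g * ⁅g⁻¹, h⁆
    rw [commutatorElement_def]; group
  have h1 : Φ.relIndex (centralMod (μ.ker.map Φ.subtype)) ≠ 1 := by
    rw [Ne, Subgroup.relIndex_eq_one]
    exact fun h => hg (inv_mem_iff.1 (h hgZ))
  have h2 : 2 ≤ Φ.relIndex (centralMod (μ.ker.map Φ.subtype)) := by omega
  nlinarith

/-- A non-powerful `2`-group with at most five rational irreducible characters has derived subgroup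
of index four, equal to its Frattini subgroup, and exactly five such characters. Two distinct signs
as in `exists_mem_IrrQ_of_sign` would give two characters besides the four linear ones; a
sign of `Φ` trivial on `G'` could be used to twist one into another. -/
theorem sqs_top_eq_commutator_of_not_powEmb {G : Type*} [Group G] [Finite G] (hG : IsPGroup 2 G)
    (hpow : ¬ PowEmb (⊤ : Subgroup G)) (h5 : (IrrQ G).encard ≤ 5) :
    ⁅(⊤ : Subgroup G), (⊤ : Subgroup G)⁆ = sqs ⊤ ∧ (sqs (⊤ : Subgroup G)).index = 4 ∧
      (IrrQ G).encard = 5 := by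
  have : Fact (Nat.Prime 2) := ⟨Nat.prime_two⟩
  have : Group.IsNilpotent G := hG.isNilpotent
  set Φ := sqs (⊤ : Subgroup G) with hΦ
  set G' := ⁅(⊤ : Subgroup G), (⊤ : Subgroup G)⁆ with hG'
  have hG'Φ : G' ≤ Φ := commutator_le_sqs_top
  have hind : Φ.index ≤ 5 := by
    have := (Set.encard_le_encard (signChars_subset_IrrQ G)).trans h5
    rw [encard_signChars] at this
    exact_mod_cast this
  set D := sqs Φ ⊔ ⁅G', (⊤ : Subgroup G)⁆ with hD
  have hG'D : ¬ G' ≤ D := fun h => hpow ⟨inferInstance, le_of_le_sup_commutator_top h⟩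
  have hΦD : ⁅Φ, (⊤ : Subgroup G)⁆ ≤ D := commutator_sqs_le (H := ⊤) hG'Φ
  obtain ⟨z, hz, hzD⟩ := SetLike.not_le_iff_exists.1 hG'D
  obtain ⟨μ, hμ2, hμD, hμz⟩ := exists_sign (H := Φ) (K := D) le_sup_left (z := ⟨z, hG'Φ hz⟩) hzD
  obtain ⟨hind2, χ, hχ, n, hn, hχΦ, hχ0⟩ := exists_mem_IrrQ_of_sign hΦ hind μ hμ2
    (fun p hp => hμD p (hΦD hp)) ⟨⟨z, hG'Φ hz⟩, hz, hμz⟩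
  have hΦtop : Φ ≠ ⊤ := fun h => by rw [h, Subgroup.index_top] at hind2; omega
  obtain ⟨g, hg⟩ : ∃ g, g ∉ Φ := by
    by_contra hall
    push Not at hall
    exact hΦtop (eq_top_iff.2 fun x _ => hall x)
  have hnotsign : ∀ ψ : G → ℂ, (∀ g ∉ Φ, ψ g = 0) → ψ ∉ signChars G := by
    rintro _ h0 ⟨l, -, rfl⟩
    exact Units.ne_zero _ (h0 g hg)
  have hind4 : Φ.index = 4 := by
    have h1 : ((Φ.index + 1 : ℕ) : ℕ∞) ≤ 5 := by
      rw [Nat.cast_add, hΦ, ← encard_signChars, Nat.cast_one,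
        ← Set.encard_insert_of_notMem (hnotsign χ hχ0)]
      exact (Set.encard_le_encard
        (Set.insert_subset hχ (signChars_subset_IrrQ G))).trans h5
    have h2 : Φ.index + 1 ≤ 5 := by exact_mod_cast h1
    obtain ⟨k, hk⟩ := hG.index Φ
    have h3 : k ≠ 0 := by rintro rfl; omega
    have h4 : k ≠ 1 := by rintro rfl; omega
    have h5 : 2 ^ 2 ≤ 2 ^ k := Nat.pow_le_pow_right two_pos (by omega)
    omega
  have hins : (insert χ (signChars G)).encard = 5 := by
    rw [Set.encard_insert_of_notMem (hnotsign χ hχ0), encard_signChars, ← hΦ, hind4]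
    norm_num
  have hsub : insert χ (signChars G) ⊆ IrrQ G := Set.insert_subset hχ (signChars_subset_IrrQ G)
  refine ⟨?_, hind4, le_antisymm h5 (hins ▸ Set.encard_le_encard hsub)⟩
  refine eq_of_le_sup_sqs hG hG'Φ ?_
  by_contra hcon
  obtain ⟨y, hy, hyK⟩ := SetLike.not_le_iff_exists.1 hcon
  obtain ⟨ν, hν2, hνK, hνy⟩ := exists_sign (H := Φ) (K := G' ⊔ sqs Φ) le_sup_right
    (z := ⟨y, hy⟩) hyK
  have hDK : D ≤ G' ⊔ sqs Φ :=
    sup_le le_sup_right ((Subgroup.commutator_le_left G' ⊤).trans le_sup_left)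
  obtain ⟨-, χ', hχ', n', hn', hχΦ', hχ0'⟩ := exists_mem_IrrQ_of_sign hΦ hind (μ * ν)
    (fun p => by rw [MonoidHom.mul_apply, mul_pow, hμ2, hν2, one_mul])
    (fun p hp => by
      rw [MonoidHom.mul_apply, hμD p (hΦD hp), hνK p (hDK (hΦD hp)), one_mul])
    ⟨⟨z, hG'Φ hz⟩, hz, by
      rwa [MonoidHom.mul_apply, hνK ⟨z, hG'Φ hz⟩ (Subgroup.mem_sup_left hz), mul_one]⟩
  have hne : χ' ≠ χ := by
    rintro rfl
    have h1 := (hχΦ' 1).symm.trans (hχΦ 1)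
    rw [map_one, map_one, Units.val_one, mul_one, mul_one] at h1
    have h2 := (hχΦ' ⟨y, hy⟩).symm.trans (hχΦ ⟨y, hy⟩)
    rw [h1, MonoidHom.mul_apply, Units.val_mul] at h2
    have h3 := mul_left_cancel₀ (by exact_mod_cast hn) h2
    refine hνy (Units.ext ?_)
    simpa using h3
  have h6 : (insert χ' (insert χ (signChars G))).encard ≤ 5 :=
    (Set.encard_le_encard (Set.insert_subset hχ' hsub)).trans h5
  rw [Set.encard_insert_of_notMem (by
    rintro (h | h)
    · exact hne h
    · exact hnotsign χ' hχ0' h), hins] at h6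
  exact absurd h6 (by decide)

/-! ### Two-groups with derived subgroup of index four -/

theorem IsPGroup.exists_mem_commutator_center {G : Type*} [Group G] [Finite G] (hG : IsPGroup 2 G)
    (h : ⁅(⊤ : Subgroup G), (⊤ : Subgroup G)⁆ ≠ ⊥) :
    ∃ z ∈ ⁅(⊤ : Subgroup G), (⊤ : Subgroup G)⁆, z ≠ 1 ∧ z ^ 2 = 1 ∧ ∀ g, Commute z g := by
  classical
  have : Fact (Nat.Prime 2) := ⟨Nat.prime_two⟩
  have : Group.IsNilpotent G := hG.isNilpotent
  -- the last nontrivial term of the lower central series is central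
  obtain ⟨n, hn⟩ : ∃ n, (⊤ : Subgroup G).lowerCentralSeries (n + 1) ≠ ⊥ ∧
      (⊤ : Subgroup G).lowerCentralSeries (n + 2) = ⊥ := by
    by_contra hcon
    push Not at hcon
    have hall : ∀ n, (⊤ : Subgroup G).lowerCentralSeries (n + 1) ≠ ⊥ := by
      intro n
      induction n with
      | zero => exact h
      | succ n ih => exact hcon n ih
    obtain ⟨n, hn⟩ := Subgroup.nilpotent_iff_lowerCentralSeries.1 ‹Group.IsNilpotent G›
    refine hall n (le_bot_iff.1 ?_)
    rw [← hn]
    exact Subgroup.lowerCentralSeries_antitone _ (Nat.le_succ n)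
  obtain ⟨x, hx, hx1⟩ := (Subgroup.ne_bot_iff_exists_ne_one.1 hn.1).elim
    fun x hx => (⟨x, x.2, fun h => hx (Subtype.ext h)⟩ :
      ∃ x ∈ (⊤ : Subgroup G).lowerCentralSeries (n + 1), x ≠ 1)
  obtain ⟨z, hz, hz1, hz2⟩ := hG.exists_mem_zpowers_sq_eq_one hx1
  have hzn := Subgroup.zpowers_le.2 hx hz
  refine ⟨z, ?_, hz1, hz2, fun g => ?_⟩
  · exact Subgroup.lowerCentralSeries_antitone ⊤ (show 1 ≤ n + 1 by omega) hzn
  · have h1 : ⁅z, g⁆ ∈ (⊤ : Subgroup G).lowerCentralSeries (n + 2) :=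
      Subgroup.commutator_mem_commutator hzn (Subgroup.mem_top g)
    rw [hn.2, Subgroup.mem_bot] at h1
    exact commutatorElement_eq_one_iff_commute.1 h1

/-- If `M` is an abelian subgroup of index two and the derived subgroup has index four, then an
element outside `M` centralises at most two elements of `M`: the derived subgroup consists of
commutators with that element. -/
theorem card_ker_commutator_le_two {G : Type*} [Group G] [Finite G] {M : Subgroup G}
    (hM : M.index = 2) (hab : ∀ x ∈ M, ∀ y ∈ M, Commute x y)
    (h4 : ⁅(⊤ : Subgroup G), (⊤ : Subgroup G)⁆.index = 4) {a : G} (ha : a ∉ M) :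
    Nat.card {m : M // Commute (m : G) a} ≤ 2 := by
  have hMn : M.Normal := Subgroup.normal_of_index_eq_two hM
  have hcM : ∀ m : M, ⁅(m : G), a⁆ ∈ M := fun m => by
    rw [commutatorElement_def, mul_assoc, mul_assoc]
    refine mul_mem m.2 ?_
    rw [← mul_assoc]
    exact hMn.conj_mem _ (inv_mem m.2) a
  let φ : M →* G :=
    { toFun := fun m => ⁅(m : G), a⁆
      map_one' := commutatorElement_one_left a
      map_mul' := fun m m' => by
        have h2 : ⁅((m * m' : M) : G), a⁆ = m * ⁅(m' : G), a⁆ * (m : G)⁻¹ * ⁅(m : G), a⁆ := by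
          rw [Subgroup.coe_mul]; simp only [commutatorElement_def]; group
        rw [h2, (hab _ m.2 _ (hcM m')).eq, mul_inv_cancel_right, (hab _ (hcM m') _ (hcM m)).eq] }
  have hφ : ∀ m : M, φ m = ⁅(m : G), a⁆ := fun _ => rfl
  have hmem : ∀ {b}, b ∉ M → a * b ∈ M := fun {b} hb =>
    (Subgroup.mul_mem_iff_of_index_two hM).2 ⟨fun h => absurd h ha, fun h => absurd h hb⟩
  have hRn : φ.range.Normal := by
    refine ⟨?_⟩
    rintro _ ⟨m, rfl⟩ g
    by_cases hg : g ∈ M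
    · rw [hφ, (hab g hg _ (hcM m)).eq, mul_inv_cancel_right]
      exact ⟨m, rfl⟩
    · refine ⟨⟨a⁻¹ * m * a, by simpa using hMn.conj_mem m m.2 a⁻¹⟩, ?_⟩
      have h1 : g * φ m * g⁻¹ = a⁻¹ * ((a * g) * φ m * (a * g)⁻¹) * a := by group
      rw [h1, hφ, hφ, (hab _ (hmem hg) _ (hcM m)).eq, mul_inv_cancel_right]
      simp only [commutatorElement_def]; group
  have hMZ : M ≤ centralMod φ.range := by
    refine fun m hm => mem_centralMod.2 fun g => ?_
    by_cases hg : g ∈ M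
    · rw [(hab m hm g hg).commutator_eq]
      exact one_mem _
    · have h1 : a⁻¹ * m⁻¹ * a ∈ M := by simpa using hMn.conj_mem _ (inv_mem hm) a⁻¹
      refine ⟨⟨a⁻¹ * m⁻¹ * a, h1⟩, ?_⟩
      have h2 : ⁅m, g⁆ = m * a⁻¹ * ((a * g) * m⁻¹ * (a * g)⁻¹) * a := by
        rw [commutatorElement_def]; group
      rw [h2, (hab _ (hmem hg) _ (inv_mem hm)).eq, mul_inv_cancel_right, hφ]
      have h3 : m * a⁻¹ * m⁻¹ * a = m * (a⁻¹ * m⁻¹ * a) := by group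
      rw [h3, (hab m hm _ h1).eq]
      simp only [commutatorElement_def]; group
  have hle : ⁅(⊤ : Subgroup G), (⊤ : Subgroup G)⁆ ≤ φ.range :=
    commutator_le_of_index_centralMod_le_two
      ((Nat.le_of_dvd two_pos (hM ▸ Subgroup.index_dvd_of_le hMZ)))
  have hker : Nat.card {m : M // Commute (m : G) a} = Nat.card φ.ker :=
    Nat.card_congr (Equiv.subtypeEquivRight fun m => by
      rw [MonoidHom.mem_ker, hφ, commutatorElement_eq_one_iff_commute])
  have h1 := Subgroup.card_mul_index φ.ker
  rw [Subgroup.index_ker] at h1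
  have h2 := Subgroup.card_mul_index M
  have h3 := Subgroup.card_mul_index ⁅(⊤ : Subgroup G), (⊤ : Subgroup G)⁆
  have h4' := Subgroup.card_le_of_le hle
  have h5 : 0 < Nat.card φ.range := Nat.card_pos
  rw [hker]
  rw [hM] at h2
  rw [h4] at h3
  by_contra hcon
  nlinarith

/-- **Taussky's theorem**: a finite `2`-group with derived subgroup of index four has a cyclic
subgroup of index two. By induction, the quotient by a central involution `z` of the derived subgroup
has such a subgroup `⟨r⟩`. If `z` is not a power of `r`, then the preimage `⟨r⟩ × ⟨z⟩` is abelian, and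
if `r ^ 2 ≠ 1`, both `z` and the involution of `⟨r ^ 2⟩` commute with an element outside it; if
`r ^ 2 = 1`, the group has order eight. -/
theorem IsPGroup.exists_zpowers_index_two {G : Type*} [Group G] [Finite G] (hG : IsPGroup 2 G)
    (h4 : ⁅(⊤ : Subgroup G), (⊤ : Subgroup G)⁆.index = 4) :
    ∃ r : G, (Subgroup.zpowers r).index = 2 := by
  have : Fact (Nat.Prime 2) := ⟨Nat.prime_two⟩
  induction hn : Nat.card G using Nat.strong_induction_on generalizing G with
  | _ n ih =>
  have hcard := Subgroup.card_mul_index ⁅(⊤ : Subgroup G), (⊤ : Subgroup G)⁆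
  rw [h4] at hcard
  by_cases hbot : ⁅(⊤ : Subgroup G), (⊤ : Subgroup G)⁆ = ⊥
  · rw [hbot, Subgroup.card_bot, one_mul] at hcard
    obtain ⟨r, hr⟩ := exists_prime_orderOf_dvd_card' (G := G) 2 (by rw [← hcard]; norm_num)
    refine ⟨r, ?_⟩
    have := Subgroup.card_mul_index (Subgroup.zpowers r)
    rw [Nat.card_zpowers, hr] at this
    omega
  obtain ⟨z, hzG, hz1, hz2, hzc⟩ := hG.exists_mem_commutator_center hbot
  have hZn : (Subgroup.zpowers z).Normal := by
    refine ⟨?_⟩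
    rintro _ ⟨m, rfl⟩ g
    refine ⟨m, ?_⟩
    change z ^ m = g * z ^ m * g⁻¹
    rw [← ((hzc g).zpow_left m).eq, mul_inv_cancel_right]
  have hZmem : ∀ y ∈ Subgroup.zpowers z, y ≠ 1 → y = z := by
    intro y hy hy1
    refine eq_of_sq_eq_one_of_mem_zpowers hy (Subgroup.mem_zpowers z) ?_ hz2 hy1 hz1
    obtain ⟨m, rfl⟩ := hy
    change (z ^ m) ^ 2 = 1
    rw [← zpow_natCast, ← zpow_mul, mul_comm, zpow_mul, zpow_natCast, hz2, one_zpow]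
  -- a cyclic subgroup of index two in the quotient by `z`
  set Q := G ⧸ Subgroup.zpowers z
  have hQcard : Nat.card Q < n := by
    have h1 := Subgroup.card_eq_card_quotient_mul_card_subgroup (Subgroup.zpowers z)
    rw [Nat.card_zpowers, orderOf_eq_prime hz2 hz1] at h1
    have : 0 < Nat.card Q := Nat.card_pos
    have h2 : Nat.card G = Nat.card Q * 2 := h1
    omega
  have hQ4 : ⁅(⊤ : Subgroup Q), (⊤ : Subgroup Q)⁆.index = 4 := by
    rw [← h4, ← Subgroup.map_top_of_surjective _ (QuotientGroup.mk'_surjective (Subgroup.zpowers z)),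
      ← Subgroup.map_commutator]
    refine Subgroup.index_map_eq _ (QuotientGroup.mk'_surjective _) ?_
    rw [QuotientGroup.ker_mk', Subgroup.zpowers_le]
    exact hzG
  obtain ⟨r', hr'⟩ := ih _ hQcard (hG.to_quotient _) hQ4 rfl
  obtain ⟨r, rfl⟩ := QuotientGroup.mk'_surjective _ r'
  set M := (Subgroup.zpowers (QuotientGroup.mk' (Subgroup.zpowers z) r)).comap
    (QuotientGroup.mk' (Subgroup.zpowers z)) with hMdef
  have hM : M.index = 2 := by
    rw [hMdef, Subgroup.index_comap_of_surjective _ (QuotientGroup.mk'_surjective _), hr']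
  have hrM : r ∈ M := Subgroup.mem_zpowers _
  have hzM : z ∈ M := by
    have : QuotientGroup.mk' (Subgroup.zpowers z) z = 1 := by
      rw [QuotientGroup.mk'_apply, QuotientGroup.eq_one_iff]
      exact Subgroup.mem_zpowers z
    rw [hMdef, Subgroup.mem_comap, this]
    exact one_mem _
  have hMmem : ∀ m ∈ M, ∃ (i : ℤ), m = r ^ i ∨ m = r ^ i * z := by
    intro m hm
    obtain ⟨i, hi⟩ := hm
    refine ⟨i, ?_⟩
    have h1 : QuotientGroup.mk' (Subgroup.zpowers z) r ^ i = QuotientGroup.mk' _ m := hi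
    rw [← map_zpow, QuotientGroup.mk'_apply, QuotientGroup.mk'_apply, QuotientGroup.eq] at h1
    by_cases h2 : (r ^ i)⁻¹ * m = 1
    · left; rw [← mul_eq_one_iff_inv_eq.1 h2, inv_inv]
    · right; rw [← hZmem _ h1 h2, mul_inv_cancel_left]
  by_cases hzr : z ∈ Subgroup.zpowers r
  · refine ⟨r, ?_⟩
    rw [← hM]
    congr 1
    refine le_antisymm (Subgroup.zpowers_le.2 hrM) fun m hm => ?_
    obtain ⟨i, rfl | rfl⟩ := hMmem m hm
    · exact ⟨i, rfl⟩
    · exact mul_mem ⟨i, rfl⟩ hzr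
  have hab : ∀ x ∈ M, ∀ y ∈ M, Commute x y := by
    intro x hx y hy
    have hrr : ∀ i j : ℤ, Commute (r ^ i) (r ^ j) := fun i j => (Commute.refl r).zpow_zpow i j
    obtain ⟨i, rfl | rfl⟩ := hMmem x hx <;> obtain ⟨j, rfl | rfl⟩ := hMmem y hy
    · exact hrr i j
    · exact (hrr i j).mul_right (hzc _).symm
    · exact (hrr i j).mul_left (hzc _)
    · exact ((hrr i j).mul_right (hzc _).symm).mul_left (hzc _)
  by_cases hr2 : r ^ 2 = 1
  · -- the group has order eight, and an element that is not an involution will do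
    have h8 : Nat.card G = 8 := by
      have h1 := Subgroup.card_eq_card_quotient_mul_card_subgroup (Subgroup.zpowers z)
      rw [Nat.card_zpowers, orderOf_eq_prime hz2 hz1] at h1
      have h2 : Nat.card G = Nat.card Q * 2 := h1
      have h3 := Subgroup.card_mul_index
        (Subgroup.zpowers (QuotientGroup.mk' (Subgroup.zpowers z) r))
      rw [hr', Nat.card_zpowers] at h3
      have h5 : orderOf (QuotientGroup.mk' (Subgroup.zpowers z) r) ≤ 2 :=
        orderOf_le_of_pow_eq_one two_pos (by rw [← map_pow, hr2, map_one])
      have h6 : Nat.card (⁅(⊤ : Subgroup G), (⊤ : Subgroup G)⁆ : Subgroup G) ≠ 1 := by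
        rwa [Ne, Subgroup.card_eq_one]
      have h7 : 0 < Nat.card (⁅(⊤ : Subgroup G), (⊤ : Subgroup G)⁆ : Subgroup G) := Nat.card_pos
      have h8 : Nat.card Q = orderOf (QuotientGroup.mk' (Subgroup.zpowers z) r) * 2 := h3.symm
      omega
    obtain ⟨x, hx⟩ : ∃ x : G, x ^ 2 ≠ 1 := by
      by_contra hall
      push Not at hall
      have hinv : ∀ g : G, g⁻¹ = g := fun g => by rw [inv_eq_iff_mul_eq_one, ← sq, hall]
      refine hbot (le_bot_iff.1 (Subgroup.commutator_le.2 fun g _ h _ => ?_))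
      rw [Subgroup.mem_bot, commutatorElement_def, hinv g, hinv h, mul_assoc, ← sq, hall]
    have hxo : orderOf x ∣ 8 := h8 ▸ orderOf_dvd_natCard x
    have hx2 : ¬ orderOf x ∣ 2 := fun h => hx (orderOf_dvd_iff_pow_eq_one.1 h)
    have h48 : orderOf x = 4 ∨ orderOf x = 8 := by
      have h9 := Nat.le_of_dvd (by norm_num) hxo
      generalize orderOf x = k at *
      interval_cases k <;> omega
    have hind : ∀ y : G, orderOf y = 4 → (Subgroup.zpowers y).index = 2 := by
      intro y hy
      have := Subgroup.card_mul_index (Subgroup.zpowers y)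
      rw [Nat.card_zpowers, hy, h8] at this
      omega
    rcases h48 with h | h
    · exact ⟨x, hind x h⟩
    · exact ⟨x ^ 2, hind _ (by rw [orderOf_pow, h]; norm_num)⟩
  · -- the involutions of `⟨r ^ 2⟩` and `z` centralise too much
    exfalso
    obtain ⟨y, hy, hy1, hy2⟩ := hG.exists_mem_zpowers_sq_eq_one hr2
    have hyr : Subgroup.zpowers (r ^ 2) ≤ Subgroup.zpowers r :=
      Subgroup.zpowers_le.2 (Subgroup.pow_mem _ (Subgroup.mem_zpowers r) 2)
    obtain ⟨a, ha⟩ : ∃ a, a ∉ M := by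
      by_contra hall
      push Not at hall
      rw [(Subgroup.eq_top_iff' M).2 hall, Subgroup.index_top] at hM
      omega
    have hMn : M.Normal := Subgroup.normal_of_index_eq_two hM
    have hyc : Commute y a := by
      have h1 : a * y * a⁻¹ ∈ Subgroup.zpowers r := by
        have h2 : a * r ^ 2 * a⁻¹ ∈ Subgroup.zpowers r := by
          rw [← conj_pow]
          obtain ⟨i, hi | hi⟩ := hMmem _ (hMn.conj_mem r hrM a)
          · rw [hi]; exact Subgroup.pow_mem _ (Subgroup.zpow_mem_zpowers r i) 2
          · rw [hi, (hzc _).symm.mul_pow, hz2, mul_one]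
            exact Subgroup.pow_mem _ (Subgroup.zpow_mem_zpowers r i) 2
        obtain ⟨i, rfl⟩ := hy
        change a * (r ^ 2) ^ i * a⁻¹ ∈ _
        rw [← conj_zpow]
        exact Subgroup.zpow_mem _ h2 i
      have h3 : a * y * a⁻¹ = y := by
        refine eq_of_sq_eq_one_of_mem_zpowers h1 (hyr hy) ?_ hy2 ?_ hy1
        · rw [conj_pow, hy2, mul_one, mul_inv_cancel]
        · rwa [Ne, conj_eq_one_iff]
      exact (mul_inv_eq_iff_eq_mul.1 h3).symm
    have hcount := card_ker_commutator_le_two hM hab h4 ha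
    have hzy : z ≠ y := fun h => hzr (h ▸ hyr hy)
    let _ := Fintype.ofFinite {m : M // Commute (m : G) a}
    rw [Nat.card_eq_fintype_card, ← not_lt, Fintype.two_lt_card_iff] at hcount
    refine hcount ⟨⟨1, Commute.one_left a⟩, ⟨⟨z, hzM⟩, hzc a⟩,
      ⟨⟨y, Subgroup.zpowers_le.2 hrM (hyr hy)⟩, hyc⟩, fun h => hz1 ?_, fun h => hy1 ?_,
      fun h => hzy ?_⟩
    · exact (congrArg (fun m => ((m.1 : M) : G)) h).symm
    · exact (congrArg (fun m => ((m.1 : M) : G)) h).symm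
    · exact congrArg (fun m => ((m.1 : M) : G)) h

/-! ### Groups with a cyclic subgroup of index two -/

/-- Counting rational classes in the presence of a cyclic subgroup `⟨r⟩` of index two, when
`G' = ⟨r ^ 2⟩ ≠ 1`. Two classes are formed by the elements outside `⟨r⟩`, and in `⟨r⟩` the rational
elements are those whose fourth power is trivial. -/
theorem encard_clQ_eq_five {G : Type*} [Group G] [Finite G] (hG : IsPGroup 2 G) {r : G}
    (hr : (Subgroup.zpowers r).index = 2) (hr2 : r ^ 2 ≠ 1)
    (hG' : ⁅(⊤ : Subgroup G), (⊤ : Subgroup G)⁆ = Subgroup.zpowers (r ^ 2)) :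
    (clQ G).encard = 5 := by
  have : Fact (Nat.Prime 2) := ⟨Nat.prime_two⟩
  have hRn : (Subgroup.zpowers r).Normal := Subgroup.normal_of_index_eq_two hr
  have hmul : ∀ {x y}, x ∉ Subgroup.zpowers r → y ∉ Subgroup.zpowers r →
      x * y ∈ Subgroup.zpowers r := fun {x y} hx hy =>
    (Subgroup.mul_mem_iff_of_index_two hr).2 ⟨fun h => absurd h hx, fun h => absurd h hy⟩
  have hrr : ∀ x ∈ Subgroup.zpowers r, ∀ y ∈ Subgroup.zpowers r, Commute x y := by
    rintro _ ⟨i, rfl⟩ _ ⟨j, rfl⟩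
    exact (Commute.refl r).zpow_zpow i j
  -- the commutator map with an element outside `⟨r⟩` is a homomorphism on `⟨r⟩`
  have hcomm : ∀ (x : G) (i : ℤ), ⁅r ^ i, x⁆ = ⁅r, x⁆ ^ i := by
    intro x i
    have h1 : Commute r (x * r⁻¹ * x⁻¹) :=
      hrr _ (Subgroup.mem_zpowers r) _ (hRn.conj_mem _ (inv_mem (Subgroup.mem_zpowers r)) x)
    have h2 : ∀ y, ⁅y, x⁆ = y * (x * y⁻¹ * x⁻¹) := fun y => by
      rw [commutatorElement_def]; group
    rw [h2, h2, h1.mul_zpow, conj_zpow, inv_zpow]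
  -- and its image is the derived subgroup
  have hgen : ∀ x ∉ Subgroup.zpowers r, r ^ 2 ∈ Subgroup.zpowers ⁅r, x⁆ := by
    intro x hx
    have hle : Subgroup.zpowers ⁅r, x⁆ ≤ Subgroup.zpowers r := by
      rw [Subgroup.zpowers_le, commutatorElement_def, mul_assoc, mul_assoc, ← mul_assoc x]
      exact mul_mem (Subgroup.mem_zpowers r)
        (hRn.conj_mem _ (inv_mem (Subgroup.mem_zpowers r)) x)
    have hTn : (Subgroup.zpowers ⁅r, x⁆).Normal := by
      refine ⟨fun t ht g => ?_⟩
      obtain ⟨m, rfl⟩ := hle ht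
      obtain ⟨k, hk⟩ := hRn.conj_mem r (Subgroup.mem_zpowers r) g
      have hk' : r ^ k = g * r * g⁻¹ := hk
      change r ^ m ∈ _ at ht
      change g * r ^ m * g⁻¹ ∈ _
      rw [← conj_zpow, ← hk', ← zpow_mul, mul_comm, zpow_mul]
      exact Subgroup.zpow_mem _ ht k
    have hRZ : Subgroup.zpowers r ≤ centralMod (Subgroup.zpowers ⁅r, x⁆) := by
      rw [Subgroup.zpowers_le, mem_centralMod]
      intro g
      by_cases hg : g ∈ Subgroup.zpowers r
      · rw [(hrr r (Subgroup.mem_zpowers r) g hg).commutator_eq]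
        exact one_mem _
      · have h1 : x⁻¹ * g ∈ Subgroup.zpowers r := hmul (fun h => hx (inv_mem_iff.1 h)) hg
        have h2 : ⁅r, g⁆ = ⁅r, x⁆ * (x * ⁅r, x⁻¹ * g⁆ * x⁻¹) := by
          simp only [commutatorElement_def]; group
        rw [h2, (hrr r (Subgroup.mem_zpowers r) _ h1).commutator_eq, mul_one, mul_inv_cancel,
          mul_one]
        exact Subgroup.mem_zpowers _
    have h3 := commutator_le_of_index_centralMod_le_two
      (Nat.le_of_dvd two_pos (hr ▸ Subgroup.index_dvd_of_le hRZ))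
    rw [hG'] at h3
    exact h3 (Subgroup.mem_zpowers _)
  have hG'R : Subgroup.zpowers (r ^ 2) ≤ Subgroup.zpowers r :=
    Subgroup.zpowers_le.2 (Subgroup.pow_mem _ (Subgroup.mem_zpowers r) 2)
  -- the class of an element outside `⟨r⟩` is a coset of the derived subgroup
  have hconj : ∀ x ∉ Subgroup.zpowers r, ∀ y ∈ Subgroup.zpowers (r ^ 2), IsConj x (y * x) := by
    intro x hx y hy
    obtain ⟨k, hk⟩ := Subgroup.zpowers_le.2 (hgen x hx) hy
    have hk' : ⁅r ^ k, x⁆ = y := (hcomm x k).trans hk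
    refine isConj_iff.2 ⟨r ^ k, ?_⟩
    rw [← hk', commutatorElement_def]; group
  have hconj' : ∀ x y, IsConj x y → y * x⁻¹ ∈ Subgroup.zpowers (r ^ 2) := by
    intro x y h
    obtain ⟨g, rfl⟩ := isConj_iff.1 h
    rw [← hG', ← commutatorElement_def]
    exact Subgroup.commutator_mem_commutator (Subgroup.mem_top _) (Subgroup.mem_top _)
  -- squares in terms of commutators
  have hsq : ∀ x ∉ Subgroup.zpowers r, ∃ k : ℤ, ∀ y ∈ Subgroup.zpowers r, y ^ 2 = ⁅y, x⁆ ^ k := by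
    intro x hx
    obtain ⟨k, hk⟩ := hgen x hx
    have hk' : ⁅r, x⁆ ^ k = r ^ 2 := hk
    refine ⟨k, ?_⟩
    rintro _ ⟨m, rfl⟩
    change (r ^ m) ^ 2 = ⁅r ^ m, x⁆ ^ k
    rw [hcomm, ← zpow_mul, mul_comm, zpow_mul, hk']
    group
  have hsqmem : ∀ x, x ^ 2 ∈ Subgroup.zpowers r := Subgroup.sq_mem_of_index_two hr
  have hsq4 : ∀ x ∉ Subgroup.zpowers r, (x ^ 2) ^ 2 = 1 := by
    intro x hx
    obtain ⟨k, hk⟩ := hsq x hx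
    have h1 := hk _ (hsqmem x)
    rwa [((Commute.refl x).pow_left 2).commutator_eq, one_zpow] at h1
  have hsqG' : ∀ x ∉ Subgroup.zpowers r, x ^ 2 ∈ Subgroup.zpowers (r ^ 2) := by
    intro x hx
    obtain ⟨m, hm⟩ := hsqmem x
    have hm' : r ^ m = x ^ 2 := hm
    rcases Int.even_or_odd' m with ⟨i, rfl | rfl⟩
    · refine ⟨i, ?_⟩
      rw [← hm', zpow_mul]
      norm_cast
    · refine absurd (hG.eq_one_of_zpow_odd (k := 2 * i + 1) ⟨i, rfl⟩ ?_) hr2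
      rw [← hsq4 x hx, ← hm', ← zpow_natCast, ← zpow_natCast, ← zpow_mul, ← zpow_mul, mul_comm]
  have hout : ∀ x ∉ Subgroup.zpowers r, IsRationalElement x := by
    intro x hx
    refine isRationalElement_of_pow_four ((pow_mul x 2 2).trans (hsq4 x hx)) ?_
    have h2 : x⁻¹ = (x ^ 2)⁻¹ * x := by rw [sq]; group
    rw [h2]
    exact hconj x hx _ (inv_mem (hsqG' x hx))
  obtain ⟨a, ha⟩ : ∃ a, a ∉ Subgroup.zpowers r := by
    by_contra hall
    push Not at hall
    rw [(Subgroup.eq_top_iff' _).2 hall, Subgroup.index_top] at hr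
    omega
  have hin : ∀ x ∈ Subgroup.zpowers r, IsRationalElement x → x ^ 4 = 1 := by
    intro x hx hxr
    have hcop : Nat.Coprime 5 (orderOf x) := by
      obtain ⟨n, hn⟩ := IsPGroup.iff_orderOf.1 hG x
      rw [hn]
      exact Nat.Coprime.pow_right n (by norm_num)
    obtain ⟨g, hg⟩ := isConj_iff.1 (hxr.isConj_pow hcop)
    by_cases hgR : g ∈ Subgroup.zpowers r
    · rw [(hrr g hgR x hx).eq, mul_inv_cancel_right, pow_succ, right_eq_mul] at hg
      exact hg
    · obtain ⟨k, hk⟩ := hsq g hgR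
      have h1 : ⁅x, g⁆ = (x ^ 4)⁻¹ := by
        have h2 : ⁅x, g⁆ = x * (g * x * g⁻¹)⁻¹ := by rw [commutatorElement_def]; group
        rw [h2, hg]; group
      have h3 := hk x hx
      rw [h1] at h3
      have h4 : x ^ 2 = 1 := by
        refine hG.eq_one_of_zpow_odd (k := 1 + 2 * k) ⟨k, by ring⟩ ?_
        rw [zpow_add, zpow_one]
        nth_rewrite 1 [h3]
        rw [zpow_mul, inv_zpow]
        norm_cast
        rw [← pow_mul, inv_mul_cancel]
      rw [show 4 = 2 * 2 from rfl, pow_mul, h4, one_pow]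
  have hin' : ∀ x ∈ Subgroup.zpowers r, x ^ 4 = 1 → IsConj x x⁻¹ := by
    intro x hx hx4
    obtain ⟨k, hk⟩ := hsq a ha
    have h1 : ⁅x, a⁆ = x ^ 2 := by
      have h2 := hk x hx
      have h3 : ⁅r, a⁆ ∈ Subgroup.zpowers (r ^ 2) := by
        rw [← hG']
        exact Subgroup.commutator_mem_commutator (Subgroup.mem_top _) (Subgroup.mem_top _)
      obtain ⟨s, hs⟩ := h3
      have hs' : ⁅r, a⁆ = (r ^ 2) ^ s := hs.symm
      obtain ⟨m, rfl⟩ := hx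
      change (r ^ m) ^ 4 = 1 at hx4
      change (r ^ m) ^ 2 = ⁅r ^ m, a⁆ ^ k at h2
      change ⁅r ^ m, a⁆ = (r ^ m) ^ 2
      have h4 : ⁅r ^ m, a⁆ = ((r ^ m) ^ 2) ^ s := by
        rw [hcomm, hs']; group
      have h5 : ((r ^ m) ^ 2) ^ (2 : ℤ) = 1 := by
        rw [← hx4]; group
      rcases Int.even_or_odd' s with ⟨i, rfl | rfl⟩
      · rw [zpow_mul, h5, one_zpow] at h4
        rw [h2, h4, one_zpow]
      · rw [h4, zpow_add, zpow_mul, h5, one_zpow, one_mul, zpow_one]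
    refine isConj_iff.2 ⟨a, ?_⟩
    have h6 : a * x * a⁻¹ = ⁅x, a⁆⁻¹ * x := by rw [commutatorElement_def]; group
    rw [h6, h1, sq]; group
  -- the elements of order dividing four in `⟨r⟩`
  obtain ⟨z, hz, hz1, hz2⟩ := hG.exists_mem_zpowers_sq_eq_one hr2
  have hzR := hG'R hz
  obtain ⟨w, hw, hwz⟩ : ∃ w ∈ Subgroup.zpowers r, w ^ 2 = z := by
    obtain ⟨m, rfl⟩ := hz
    exact ⟨r ^ m, ⟨m, rfl⟩, by change (r ^ m) ^ 2 = (r ^ 2) ^ m; group⟩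
  have hw4 : w ^ 4 = 1 := by rw [show 4 = 2 * 2 from rfl, pow_mul, hwz, hz2]
  have hlist : ∀ x ∈ Subgroup.zpowers r, x ^ 4 = 1 → x = 1 ∨ x = z ∨ x = w ∨ x = w⁻¹ := by
    intro x hx hx4
    by_cases hx2 : x ^ 2 = 1
    · by_cases hx1 : x = 1
      · exact Or.inl hx1
      · exact Or.inr (Or.inl (eq_of_sq_eq_one_of_mem_zpowers hx hzR hx2 hz2 hx1 hz1))
    · have h1 : x ^ 2 = z := eq_of_sq_eq_one_of_mem_zpowers (Subgroup.pow_mem _ hx 2) hzR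
        (by rw [← pow_mul]; exact hx4) hz2 hx2 hz1
      by_cases hxw : x = w
      · exact Or.inr (Or.inr (Or.inl hxw))
      · have h2 : x * w⁻¹ = z := by
          refine eq_of_sq_eq_one_of_mem_zpowers (mul_mem hx (inv_mem hw)) hzR ?_ hz2
            (fun h => hxw (mul_inv_eq_one.1 h)) hz1
          rw [(hrr x hx _ (inv_mem hw)).mul_pow, inv_pow, h1, hwz, mul_inv_cancel]
        right; right; right
        rw [mul_inv_eq_iff_eq_mul] at h2
        rw [h2, eq_inv_iff_mul_eq_one, mul_assoc, ← sq, hwz, ← sq, hz2]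
  have hra : r * a ∉ Subgroup.zpowers r := fun h =>
    ha ((Subgroup.mul_mem_cancel_left _ (Subgroup.mem_zpowers r)).1 h)
  have heven : ∀ i : ℤ, r ^ (2 * i) ∈ Subgroup.zpowers (r ^ 2) := fun i =>
    ⟨i, by rw [zpow_mul]; norm_cast⟩
  have hset : clQ G = {ConjClasses.mk 1, ConjClasses.mk z, ConjClasses.mk w, ConjClasses.mk a,
      ConjClasses.mk (r * a)} := by
    ext K
    simp only [Set.mem_insert_iff, Set.mem_singleton_iff]
    constructor
    · rintro ⟨x, hx, rfl⟩
      by_cases hxR : x ∈ Subgroup.zpowers r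
      · rcases hlist x hxR (hin x hxR hx) with rfl | rfl | rfl | rfl
        · exact Or.inl rfl
        · exact Or.inr (Or.inl rfl)
        · exact Or.inr (Or.inr (Or.inl rfl))
        · exact Or.inr (Or.inr (Or.inl
            (ConjClasses.mk_eq_mk_iff_isConj.2 (hin' w hw hw4).symm)))
      · obtain ⟨m, hm⟩ := hmul hxR (fun h => ha (inv_mem_iff.1 h))
        have hm' : r ^ m = x * a⁻¹ := hm
        rw [eq_mul_inv_iff_mul_eq] at hm'
        right; right; right
        rcases Int.even_or_odd' m with ⟨i, rfl | rfl⟩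
        · left
          rw [← hm']
          exact ConjClasses.mk_eq_mk_iff_isConj.2
            (hconj a ha _ (heven i)).symm
        · right
          rw [← hm', zpow_add, zpow_one, mul_assoc]
          exact ConjClasses.mk_eq_mk_iff_isConj.2
            (hconj _ hra _ (heven i)).symm
    · rintro (rfl | rfl | rfl | rfl | rfl)
      · exact ⟨1, isRationalElement_of_sq (one_pow 2), rfl⟩
      · exact ⟨z, isRationalElement_of_sq hz2, rfl⟩
      · exact ⟨w, isRationalElement_of_pow_four hw4 (hin' w hw hw4), rfl⟩
      · exact ⟨a, hout a ha, rfl⟩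
      · exact ⟨_, hout _ hra, rfl⟩
  have hne : ∀ x ∈ Subgroup.zpowers r, ∀ y ∉ Subgroup.zpowers r,
      ConjClasses.mk x ≠ ConjClasses.mk y := by
    intro x hx y hy h
    obtain ⟨g, rfl⟩ := isConj_iff.1 (ConjClasses.mk_eq_mk_iff_isConj.1 h)
    exact hy (hRn.conj_mem x hx g)
  have hne' : ∀ x y : G, x ^ 2 = 1 → y ^ 2 ≠ 1 → ConjClasses.mk x ≠ ConjClasses.mk y := by
    intro x y hx hy h
    obtain ⟨g, rfl⟩ := isConj_iff.1 (ConjClasses.mk_eq_mk_iff_isConj.1 h)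
    rw [conj_pow, hx, mul_one, mul_inv_cancel] at hy
    exact hy rfl
  have h1z : ConjClasses.mk 1 ≠ ConjClasses.mk z := fun h =>
    hz1 (isConj_one_right.1 (ConjClasses.mk_eq_mk_iff_isConj.1 h))
  have haa : ConjClasses.mk a ≠ ConjClasses.mk (r * a) := by
    intro h
    have h1 := hconj' _ _ (ConjClasses.mk_eq_mk_iff_isConj.1 h)
    rw [mul_inv_cancel_right] at h1
    obtain ⟨i, hi⟩ := h1
    have hi' : (r ^ 2) ^ i = r := hi
    have h2 : r = 1 := by
      refine hG.eq_one_of_zpow_odd (k := 2 * i - 1) ⟨i - 1, by ring⟩ ?_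
      rw [zpow_sub, zpow_mul, zpow_one, mul_inv_eq_one]
      exact_mod_cast hi'
    exact hr2 (by rw [h2, one_pow])
  have hw2 : w ^ 2 ≠ 1 := by rwa [hwz]
  have h1R := one_mem (Subgroup.zpowers r)
  rw [hset, Set.encard_insert_of_notMem, Set.encard_insert_of_notMem,
    Set.encard_insert_of_notMem, Set.encard_pair haa]
  · norm_num
  · simp only [Set.mem_insert_iff, Set.mem_singleton_iff, not_or]
    exact ⟨hne w hw a ha, hne w hw _ hra⟩
  · simp only [Set.mem_insert_iff, Set.mem_singleton_iff, not_or]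
    exact ⟨hne' z w hz2 hw2, hne z hzR a ha, hne z hzR _ hra⟩
  · simp only [Set.mem_insert_iff, Set.mem_singleton_iff, not_or]
    exact ⟨h1z, hne' 1 w (one_pow 2) hw2, hne 1 h1R a ha, hne 1 h1R _ hra⟩

theorem mainTheorem6 (G : Type*) [Group G] [Finite G] (hG : IsPGroup 2 G)
    (h : (IrrQ G).encard ≤ 5) :
    (clQ G).encard = (IrrQ G).encard := by
  by_cases hpow : PowEmb (⊤ : Subgroup G)
  · refine encard_clQ_of_powEmb hG hpow ?_
    have h1 : (sqs (⊤ : Subgroup G)).index ≤ 5 := by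
      have := (Set.encard_le_encard (signChars_subset_IrrQ G)).trans h
      rw [encard_signChars] at this
      exact_mod_cast this
    obtain ⟨k, hk⟩ := hG.index (sqs (⊤ : Subgroup G))
    rcases Nat.lt_or_ge k 3 with hk3 | hk3
    · rw [hk]
      exact Nat.pow_le_pow_right two_pos (Nat.lt_succ_iff.1 hk3)
    · have := Nat.pow_le_pow_right two_pos hk3
      omega
  · obtain ⟨hcomm, hind, h5⟩ := sqs_top_eq_commutator_of_not_powEmb hG hpow h
    rw [h5]
    obtain ⟨r, hr⟩ := hG.exists_zpowers_index_two (hcomm ▸ hind)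
    have hle : Subgroup.zpowers (r ^ 2) ≤ sqs ⊤ :=
      Subgroup.zpowers_le.2 (sq_mem_sqs (Subgroup.mem_top r))
    -- comparing orders, `⟨r ^ 2⟩` is the Frattini subgroup
    have hcard1 := Subgroup.card_mul_index (Subgroup.zpowers r)
    have hcard2 := Subgroup.card_mul_index (sqs (⊤ : Subgroup G))
    rw [hr, Nat.card_zpowers] at hcard1
    rw [hind] at hcard2
    have hord : orderOf r = 2 * Nat.card (sqs (⊤ : Subgroup G)) := by omega
    have hord2 : orderOf (r ^ 2) = Nat.card (sqs (⊤ : Subgroup G)) := by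
      rw [orderOf_pow_of_dvd two_ne_zero ⟨_, hord⟩, hord, Nat.mul_div_cancel_left _ two_pos]
    have heq : Subgroup.zpowers (r ^ 2) = sqs ⊤ :=
      Subgroup.eq_of_le_of_card_ge hle (by rw [Nat.card_zpowers, hord2])
    refine encard_clQ_eq_five hG hr (fun h1 => hpow ⟨inferInstance, ?_⟩) (hcomm.trans heq.symm)
    rw [hcomm, ← heq, h1, Subgroup.zpowers_one_eq_bot]
    exact bot_le
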